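/- Let $w\in\mathfrak S_n$ be fully supported, i.e. $\{w(1),\dots,w(r)\}\neq\{1,\dots,r\}$ for all $1\le r<n$. Elnitsky's polygon $X(w)$ is the equilateral $2n$-gon whose sides are labeled $1,\dots,n,w(n),\dots,w(1)$ in counterclockwise order from the top vertex, in which sides with the same label are parallel and the first $n$ sides (the leftside boundary) form half of a convex, centrally symmetric $2n$-gon. A rhombic tiling of $X(w)$ is a tiling by rhombi whose edges are all congruent and parallel to sides of $X(w)$; the labels of a tile are the labels of the sides to which its edges are parallel. A tile is a left-perimeter tile if it shares two consecutive edges with the leftside boundary, and a forced left-perimeter tile for $w$ is a tile that appears as a left-perimeter tile in every rhombic tiling of $X(w)$. Then for every $1\le k<n$ the following are equivalent: (i) there is a forced left-perimeter tile for $w$ with labels $\{k,k+1\}$; (ii) $w^{-1}(k)>w^{-1}(k+1)$, and $k$ and $k+1$ do not occur together in a $321$-pattern of $w$ (that is, there are no positions $a<b<c$ with $w(a)>w(b)>w(c)$ and $k,k+1\in\{w(a),w(b),w(c)\}$); (iii) $k+1$ is a left-to-right maximum of $w$ and $k$ is a right-to-left minimum of $w$ (that is, every entry to the left of $k+1$ in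 the one-line notation $w(1)\cdots w(n)$ is smaller than $k+1$, and every entry to the right of $k$ is larger than $k$). -/

import Mathlib

noncomputable section

namespace Elnitsky

/-! Labels `1, …, n` are represented by `Fin n` (shifted by one), so a permutation in one-line
notation `w(1) w(2) ⋯ w(n)` is `w : Equiv.Perm (Fin n)`. The plane is `ℂ`. -/

/-- `w` is fully supported: `{w(1), …, w(r)} ≠ {1, …, r}` for all `1 ≤ r < n`. -/
def FullySupported {n : ℕ} (w : Equiv.Perm (Fin n)) : Prop :=
  ∀ r : ℕ, 1 ≤ r → r < n → w '' {i : Fin n | i.val < r} ≠ {i : Fin n | i.val < r}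

/-- Admissible edge directions: the sides `1, …, n`, traversed in this order, all go downwards and
keep turning counterclockwise by a total angle less than `π`. Up to a rotation, this says that they
form half of a convex (centrally symmetric) equilateral `2n`-gon, on its left side. -/
def Admissible {n : ℕ} (θ : Fin n → ℝ) : Prop :=
  StrictMono θ ∧ ∀ i, θ i ∈ Set.Ioo Real.pi (2 * Real.pi)

/-- The unit vector along which a side labeled `i` is traversed from top to bottom. -/
def dir {n : ℕ} (θ : Fin n → ℝ) (i : Fin n) : ℂ :=
  Complex.exp ((θ i : ℂ) * Complex.I)

/-- The vertex reached from the top vertex `0` after the first `m` sides of the downward path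
whose consecutive sides are labeled `σ(1), σ(2), …, σ(n)`. -/
def pathVertex {n : ℕ} (θ : Fin n → ℝ) (σ : Equiv.Perm (Fin n)) (m : ℕ) : ℂ :=
  ∑ i : Fin n with i.val < m, dir θ (σ i)

/-- The side number `m` of that path; its label is `σ m`. -/
def pathEdge {n : ℕ} (θ : Fin n → ℝ) (σ : Equiv.Perm (Fin n)) (m : Fin n) : Set ℂ :=
  segment ℝ (pathVertex θ σ m.val) (pathVertex θ σ (m.val + 1))

/-- The side labeled `m` of the leftside boundary, which is labeled `1, …, n` from top to bottom. -/
def leftEdge {n : ℕ} (θ : Fin n → ℝ) (m : Fin n) : Set ℂ :=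
  pathEdge θ 1 m

/-- The leftside boundary of the polygon. -/
def leftBoundary {n : ℕ} (θ : Fin n → ℝ) : Set ℂ :=
  ⋃ m : Fin n, leftEdge θ m

/-- The rightside boundary of the polygon of `w`, labeled `w(1), …, w(n)` from top to bottom. -/
def rightBoundary {n : ℕ} (θ : Fin n → ℝ) (w : Equiv.Perm (Fin n)) : Set ℂ :=
  ⋃ m : Fin n, pathEdge θ w m

/-- Elnitsky's polygon `X(w)` (as a closed region): both boundary paths go strictly downwards, so
the region that they enclose consists of the points that lie, at their height, between the point
of the left path and the point of the right path. -/
def polygon {n : ℕ} (θ : Fin n → ℝ) (w : Equiv.Perm (Fin n)) : Set ℂ :=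
  {p | ∃ l ∈ leftBoundary θ, ∃ r ∈ rightBoundary θ w,
    l.im = p.im ∧ r.im = p.im ∧ l.re ≤ p.re ∧ p.re ≤ r.re}

/-- A rhombic tile, given by its top vertex and its labels `{i < j}`. -/
structure Tile (n : ℕ) where
  /-- the top vertex -/
  top : ℂ
  /-- the smaller label -/
  i : Fin n
  /-- the larger label -/
  j : Fin n
  lt : i < j

/-- The set of labels of a tile. -/
def Tile.labels {n : ℕ} (t : Tile n) : Set (Fin n) := {t.i, t.j}

/-- The closed rhombus occupied by a tile: its sides are unit segments parallel to the sides of the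
polygon with the labels of the tile. -/
def Tile.carrier {n : ℕ} (θ : Fin n → ℝ) (t : Tile n) : Set ℂ :=
  {p | ∃ a ∈ Set.Icc (0 : ℝ) 1, ∃ b ∈ Set.Icc (0 : ℝ) 1,
    p = t.top + (a : ℂ) * dir θ t.i + (b : ℂ) * dir θ t.j}

/-- The four edges of a tile. -/
def Tile.edges {n : ℕ} (θ : Fin n → ℝ) (t : Tile n) : Set (Set ℂ) :=
  {segment ℝ t.top (t.top + dir θ t.i),
   segment ℝ t.top (t.top + dir θ t.j),
   segment ℝ (t.top + dir θ t.j) (t.top + dir θ t.i + dir θ t.j),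
   segment ℝ (t.top + dir θ t.i) (t.top + dir θ t.i + dir θ t.j)}

/-- `T` is a rhombic tiling of `X(w)`: the tiles cover the polygon exactly and have pairwise
disjoint interiors. -/
structure IsRhombicTiling {n : ℕ} (θ : Fin n → ℝ) (w : Equiv.Perm (Fin n))
    (T : Finset (Tile n)) : Prop where
  cover : (⋃ t ∈ T, t.carrier θ) = polygon θ w
  disjoint : ∀ s ∈ T, ∀ t ∈ T, s ≠ t →
    Disjoint (interior (s.carrier θ)) (interior (t.carrier θ))

/-- The tile shares two consecutive edges with the leftside boundary. -/
def SharesLeft {n : ℕ} (θ : Fin n → ℝ) (t : Tile n) : Prop :=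
  ∃ m m' : Fin n, m'.val = m.val + 1 ∧ leftEdge θ m ∈ t.edges θ ∧ leftEdge θ m' ∈ t.edges θ

/-- `t` is a forced left-perimeter tile for `w`: it appears, as a left-perimeter tile, in every
rhombic tiling of `X(w)`. -/
def IsForcedLeftTile {n : ℕ} (θ : Fin n → ℝ) (w : Equiv.Perm (Fin n)) (t : Tile n) : Prop :=
  ∀ T : Finset (Tile n), IsRhombicTiling θ w T → t ∈ T ∧ SharesLeft θ t

/-- The values `x` and `y` occur together in a `321`-pattern of `w`. -/
def TogetherIn321 {n : ℕ} (w : Equiv.Perm (Fin n)) (x y : Fin n) : Prop :=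
  ∃ a b c : Fin n, a < b ∧ b < c ∧ w b < w a ∧ w c < w b ∧
    x ∈ ({w a, w b, w c} : Set (Fin n)) ∧ y ∈ ({w a, w b, w c} : Set (Fin n))

/-- The value `v` is a left-to-right maximum of `w`: all entries to its left are smaller. -/
def IsLRMax {n : ℕ} (w : Equiv.Perm (Fin n)) (v : Fin n) : Prop :=
  ∀ p : Fin n, p < w.symm v → w p < v

/-- The value `v` is a right-to-left minimum of `w`: all entries to its right are larger. -/
def IsRLMin {n : ℕ} (w : Equiv.Perm (Fin n)) (v : Fin n) : Prop :=
  ∀ p : Fin n, w.symm v < p → v < w p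

end Elnitsky

end

/-!
A tiling of `X(w)` is swept by moving the leftside boundary to the right across one tile at a time.
Each intermediate path is given by a permutation `σ`, and the tile that is crossed sits at an ascent
of `σ`, so that the path becomes that of `σ * swap m m'`; conversely, as `w` is fully supported,
every such peeling comes from a tiling. A tile that can be crossed next exists for the following
reason: among the depths at which the path runs along a lower left side of an unpeeled tile, take
the infimum; there the path also meets an upper left side, and both sides belong to one tile.

If `k + 1` is a left-to-right maximum and `k` a right-to-left minimum of `w`, then no label can pass
either of them as long as `k` precedes `k + 1`, so the tile in which they cross touches the leftside
boundary. If `k` and `k + 1` lie in a `321`-pattern, some peeling makes the pattern consecutive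
before inverting `k` and `k + 1`, with the third label on the wrong side. The top vertex of the
resulting tile is then not on the leftside boundary, as the vertices of the latter are extremal.
-/

noncomputable section

namespace Elnitsky

open Equiv Set

section Permutations

variable {n : ℕ} {σ w : Perm (Fin n)} {m m' a b k k' : Fin n}

theorem symm_mul_swap_apply (σ : Perm (Fin n)) (m m' v : Fin n) :
    (σ * swap m m').symm v = swap m m' (σ.symm v) := by
  rw [symm_apply_eq, Perm.mul_apply, swap_apply_self, apply_symm_apply]

theorem swap_lt_swap {p q : Fin n} (hm : m'.val = m.val + 1) (hpq : p < q)
    (hne : ¬ (p = m ∧ q = m')) : swap m m' p < swap m m' q := by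
  simp only [swap_apply_def, Fin.ext_iff, Fin.lt_def] at *
  split_ifs <;> omega

theorem symm_mul_swap_lt (hm : m'.val = m.val + 1) (hab : σ.symm a < σ.symm b)
    (hne : ¬ (a = σ m ∧ b = σ m')) : (σ * swap m m').symm a < (σ * swap m m').symm b := by
  rw [symm_mul_swap_apply, symm_mul_swap_apply]
  exact swap_lt_swap hm hab (by rwa [symm_apply_eq, symm_apply_eq])

theorem symm_lt_of_symm_mul_swap_lt (hm : m'.val = m.val + 1)
    (hab : (σ * swap m m').symm a < (σ * swap m m').symm b)
    (hne : ¬ (a = σ m' ∧ b = σ m)) : σ.symm a < σ.symm b := by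
  have := symm_mul_swap_lt hm hab (by simpa using hne)
  rwa [mul_swap_mul_self] at this

theorem symm_mul_swap_apply_right_lt (hm : m'.val = m.val + 1) :
    (σ * swap m m').symm (σ m') < (σ * swap m m').symm (σ m) := by
  simp [symm_mul_swap_apply, Fin.lt_def, hm]

theorem exists_descent_of_lt {α : Type*} [LinearOrder α] {f : Fin n → α} {p q : Fin n}
    (hpq : p < q) (h : f q < f p) :
    ∃ m m' : Fin n, m'.val = m.val + 1 ∧ p ≤ m ∧ m' ≤ q ∧ f m' < f m := by
  by_contra! hcon
  refine h.not_ge (monotoneOn_of_le_succ Set.ordConnected_Icc (fun m hm hmem hmem' => ?_)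
    (Set.left_mem_Icc.2 hpq.le) (Set.right_mem_Icc.2 hpq.le) hpq.le)
  refine hcon m _ ?_ hmem.1 hmem'.2
  exact (Nat.covBy_iff_add_one_eq.1 (Fin.covBy_iff.1 (Order.covBy_succ_of_not_isMax hm))).symm

theorem exists_descent (h : σ ≠ 1) : ∃ m m' : Fin n, m'.val = m.val + 1 ∧ σ m' < σ m := by
  have hσ : ¬ Monotone σ := fun hmono => h ((Perm.monotone_iff σ).1 hmono)
  simp only [Monotone, not_forall, not_le] at hσ
  obtain ⟨p, q, hpq, hlt⟩ := hσ
  have hne : p ≠ q := fun e => hlt.ne (congrArg σ e.symm)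
  obtain ⟨m, m', hm, -, -, hd⟩ := exists_descent_of_lt (hpq.lt_of_ne hne) hlt
  exact ⟨m, m', hm, hd⟩

theorem descent_induction {P : Perm (Fin n) → Prop}
    (h : ∀ σ : Perm (Fin n),
      (∀ m m' : Fin n, m'.val = m.val + 1 → σ m' < σ m → P (σ * swap m m')) → P σ)
    (σ : Perm (Fin n)) : P σ := by
  -- Undoing a descent makes the one-line notation lexicographically smaller.
  have hwf : WellFounded fun σ τ : Perm (Fin n) => toLex ⇑σ < toLex ⇑τ :=
    InvImage.wf (fun σ : Perm (Fin n) => toLex ⇑σ) wellFounded_lt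
  refine hwf.induction σ fun σ ih => h σ fun m m' hm hd => ih _ ?_
  exact Pi.lex_desc (show m ≤ m' by rw [Fin.le_def]; omega) hd

theorem eq_of_forall_lt_iff_apply_lt (h : ∀ p, p < a ↔ w p < b) : a = b := by
  have hmap : (Finset.Iio a).map w.toEmbedding = Finset.Iio b := by
    ext v
    simp [Finset.mem_map_equiv, h]
  have hcard := congrArg Finset.card hmap
  rw [Finset.card_map, Fin.card_Iio, Fin.card_Iio] at hcard
  exact Fin.ext hcard

theorem FullySupported.not_forall_lt_iff_apply_lt (hw : FullySupported w) (hb : 0 < b.val) :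
    ¬ ∀ p, p < a ↔ w p < b := by
  intro h
  obtain rfl := eq_of_forall_lt_iff_apply_lt h
  refine hw a.val hb a.isLt (Set.ext fun v => ?_)
  rw [Set.mem_image_equiv]
  simpa using h (w.symm v)

theorem FullySupported.not_forall_lt_symm_iff_apply_lt (hw : FullySupported w) (hn : 2 ≤ n)
    (l : Fin n) : ¬ ∀ p, p < w.symm l ↔ w p < l := by
  intro h
  rcases Nat.eq_zero_or_pos l.val with h0 | hpos
  · have hl : w l = l := (w.symm_apply_eq.1 (eq_of_forall_lt_iff_apply_lt h)).symm
    have hlt : ∀ q : Fin n, q < ⟨1, hn⟩ ↔ q = l := fun q => by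
      rw [Fin.lt_def, Fin.ext_iff, h0, Nat.lt_one_iff]
    refine hw.not_forall_lt_iff_apply_lt (a := ⟨1, hn⟩) (b := ⟨1, hn⟩) one_pos fun p => ?_
    rw [hlt, hlt, ← w.injective.eq_iff, hl]
  · exact hw.not_forall_lt_iff_apply_lt hpos h

theorem FullySupported.symm_lt_symm (hw : FullySupported w) (hk : k'.val = k.val + 1)
    (hmax : IsLRMax w k') (hmin : IsRLMin w k) : w.symm k' < w.symm k := by
  by_contra! hle
  have hlt : w.symm k < w.symm k' := hle.lt_of_ne fun e => by
    have := congrArg Fin.val (w.symm.injective e)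
    omega
  refine hw.not_forall_lt_iff_apply_lt (a := w.symm k') (b := k') (by omega) fun p => ?_
  refine ⟨hmax p, fun hp => ?_⟩
  by_contra! hle
  have := hmin p (hlt.trans_le hle)
  rw [Fin.lt_def] at this hp
  omega

theorem IsLRMax.not_togetherIn321 (hk : k'.val = k.val + 1) (hmax : IsLRMax w k')
    (hmin : IsRLMin w k) : ¬ TogetherIn321 w k k' := by
  rintro ⟨a, b, c, hab, hbc, hba, hcb, hx, hy⟩
  have hkb : k = w b → k < w c := fun e => hmin c (by rwa [e, symm_apply_apply])
  have hkb' : k' = w b → w a < k' := fun e => hmax a (by rwa [e, symm_apply_apply])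
  simp only [Set.mem_insert_iff, Set.mem_singleton_iff] at hx hy
  simp only [Fin.lt_def, Fin.ext_iff] at hba hcb hkb hkb' hx hy
  omega

theorem isLRMax_of_not_togetherIn321 (hk : k < k') (hinv : w.symm k' < w.symm k)
    (hnot : ¬ TogetherIn321 w k k') : IsLRMax w k' := by
  intro p hp
  by_contra! hle
  have hlt : k' < w p := hle.lt_of_ne (by rintro rfl; simp at hp)
  exact hnot ⟨p, _, _, hp, hinv, by simpa using hlt, by simpa using hk, by simp, by simp⟩

theorem isRLMin_of_not_togetherIn321 (hk : k < k') (hinv : w.symm k' < w.symm k)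
    (hnot : ¬ TogetherIn321 w k k') : IsRLMin w k := by
  intro p hp
  by_contra! hle
  have hlt : w p < k := hle.lt_of_ne (by rintro rfl; simp at hp)
  exact hnot ⟨_, _, p, hinv, hp, by simpa using hk, by simpa using hlt, by simp, by simp⟩

theorem FullySupported.not_togetherIn321_iff (hw : FullySupported w) (hk : k'.val = k.val + 1) :
    (w.symm k' < w.symm k ∧ ¬ TogetherIn321 w k k') ↔ (IsLRMax w k' ∧ IsRLMin w k) := by
  have hkk' : k < k' := by rw [Fin.lt_def]; omega
  constructor
  · rintro ⟨hinv, hnot⟩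
    exact ⟨isLRMax_of_not_togetherIn321 hkk' hinv hnot, isRLMin_of_not_togetherIn321 hkk' hinv hnot⟩
  · rintro ⟨hmax, hmin⟩
    exact ⟨hw.symm_lt_symm hk hmax hmin, hmax.not_togetherIn321 hk hmin⟩

end Permutations

section Peelings

variable {n : ℕ} {θ : Fin n → ℝ} {σ w : Perm (Fin n)} {T : Set (Tile n)} {m m' a b k k' : Fin n}

/-- The tile that sits in the corner of the path `σ` between its consecutive sides `m` and `m'`. -/
def cornerTile (θ : Fin n → ℝ) (σ : Perm (Fin n)) (m m' : Fin n) (h : σ m < σ m') : Tile n :=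
  ⟨pathVertex θ σ m.val, σ m, σ m', h⟩

/-- `Peels θ w σ T`: the path `σ` can be moved to the path `w` across one corner tile after another,
and `T` is the set of the tiles that are crossed. -/
inductive Peels (θ : Fin n → ℝ) (w : Perm (Fin n)) : Perm (Fin n) → Set (Tile n) → Prop
  | refl : Peels θ w w ∅
  | step (σ : Perm (Fin n)) (m m' : Fin n) (hm : m'.val = m.val + 1) (h : σ m < σ m')
      (T : Set (Tile n)) (hT : Peels θ w (σ * swap m m') T) :
      Peels θ w σ (insert (cornerTile θ σ m m' h) T)

namespace Peels

theorem finite (h : Peels θ w σ T) : T.Finite := by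
  induction h with
  | refl => exact Set.finite_empty
  | step _ _ _ _ _ _ _ ih => exact ih.insert _

theorem inv_of_inv (h : Peels θ w σ T) (hab : a < b) (hσ : σ.symm b < σ.symm a) :
    w.symm b < w.symm a := by
  induction h with
  | refl => exact hσ
  | step σ m m' hm h _ _ ih =>
    refine ih (symm_mul_swap_lt hm hσ ?_)
    rintro ⟨rfl, rfl⟩
    exact hab.not_gt h

theorem symm_lt_of_mem (h : Peels θ w σ T) {s : Tile n} (hs : s ∈ T) :
    σ.symm s.i < σ.symm s.j := by
  induction h with
  | refl => exact hs.elim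
  | step σ m m' hm h _ _ ih =>
    rcases hs with rfl | hs
    · simp [cornerTile, Fin.lt_def, hm]
    · refine symm_lt_of_symm_mul_swap_lt hm (ih hs) fun ⟨hi, hj⟩ => ?_
      exact (hi ▸ hj ▸ s.lt).not_gt h

theorem inv_of_mem (h : Peels θ w σ T) {s : Tile n} (hs : s ∈ T) :
    w.symm s.j < w.symm s.i := by
  induction h with
  | refl => exact hs.elim
  | step σ m m' hm h T hT ih =>
    rcases hs with rfl | hs
    · exact hT.inv_of_inv h (symm_mul_swap_apply_right_lt hm)
    · exact ih hs

theorem not_labels_of_mul_swap (hm : m'.val = m.val + 1) (h : Peels θ w (σ * swap m m') T)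
    {s : Tile n} (hs : s ∈ T) : ¬ (s.i = σ m ∧ s.j = σ m') := by
  rintro ⟨hi, hj⟩
  have := h.symm_lt_of_mem hs
  rw [hi, hj] at this
  exact this.not_gt (symm_mul_swap_apply_right_lt hm)

theorem eq_of_labels (h : Peels θ w σ T) {s t : Tile n} (hs : s ∈ T) (ht : t ∈ T)
    (hi : s.i = t.i) (hj : s.j = t.j) : s = t := by
  induction h with
  | refl => exact hs.elim
  | step σ m m' hm h T hT ih =>
    rcases hs with rfl | hs <;> rcases ht with rfl | ht
    · rfl
    · exact (hT.not_labels_of_mul_swap hm ht ⟨hi.symm, hj.symm⟩).elim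
    · exact (hT.not_labels_of_mul_swap hm hs ⟨hi, hj⟩).elim
    · exact ih hs ht

theorem exists_crossing (h : Peels θ w σ T) (hσ : σ.symm a < σ.symm b)
    (hw : w.symm b < w.symm a) :
    ∃ (τ : Perm (Fin n)) (T' : Set (Tile n)) (m m' : Fin n) (hlt : τ m < τ m'),
      Peels θ w τ T' ∧ m < m' ∧ τ m = a ∧ τ m' = b ∧ cornerTile θ τ m m' hlt ∈ T := by
  induction h with
  | refl => exact (hσ.not_gt hw).elim
  | step σ m m' hm h T hT ih =>
    by_cases hab : a = σ m ∧ b = σ m'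
    · exact ⟨σ, _, m, m', h, step σ m m' hm h T hT, by rw [Fin.lt_def]; omega, hab.1.symm,
        hab.2.symm, Set.mem_insert _ _⟩
    · obtain ⟨τ, T', l, l', hlt, hp, hl, ha, hb, hmem⟩ := ih (symm_mul_swap_lt hm hσ hab)
      exact ⟨τ, T', l, l', hlt, hp, hl, ha, hb, Set.mem_insert_of_mem _ hmem⟩

/-- Nothing can pass `k` or `k'` as long as `k` precedes `k'`. -/
theorem symm_lt_symm_iff_of_isLRMax (h : Peels θ w σ T) (hk : k'.val = k.val + 1)
    (hmax : IsLRMax w k') (hmin : IsRLMin w k) (hσ : σ.symm k < σ.symm k') (v : Fin n) :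
    σ.symm v < σ.symm k ↔ v < k := by
  have hge (hv : v < k) : σ.symm v ≤ σ.symm k := by
    by_contra! hlt
    have := hmin (w.symm v) (h.inv_of_inv hv hlt)
    rw [apply_symm_apply] at this
    exact this.not_gt hv
  have hle (hv : k' < v) : σ.symm k' ≤ σ.symm v := by
    by_contra! hlt
    have := hmax (w.symm v) (h.inv_of_inv hv hlt)
    rw [apply_symm_apply] at this
    exact this.not_gt hv
  rcases lt_trichotomy v k with hv | rfl | hv
  · exact iff_of_true ((hge hv).lt_of_ne (σ.symm.injective.ne hv.ne)) hv
  · simp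
  · refine iff_of_false (fun hlt => ?_) hv.not_gt
    rcases eq_or_ne v k' with rfl | hne
    · exact hlt.not_gt hσ
    · have hv' : k' < v := by
        rw [Fin.lt_def] at hv ⊢
        have := Fin.val_ne_of_ne hne
        omega
      exact (hlt.trans hσ).not_ge (hle hv')

theorem undo (h : Peels θ w σ T) (hm : m'.val = m.val + 1) (hd : σ m' < σ m) :
    Peels θ w (σ * swap m m') (insert (cornerTile θ (σ * swap m m') m m' (by simpa using hd)) T) :=
  step _ m m' hm _ T (by rwa [mul_swap_mul_self])

theorem exists_one (h : Peels θ w σ T) : ∃ T', T ⊆ T' ∧ Peels θ w 1 T' := by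
  induction σ using descent_induction generalizing T with
  | h σ ih =>
    rcases eq_or_ne σ 1 with rfl | hσ
    · exact ⟨T, subset_rfl, h⟩
    · obtain ⟨m, m', hm, hd⟩ := exists_descent hσ
      obtain ⟨T', hT', hp⟩ := ih m m' hm hd (h.undo hm hd)
      exact ⟨T', (Set.subset_insert _ _).trans hT', hp⟩

theorem exists_consecutive (h : Peels θ w σ T) {x y z : Fin n} (hyx : y < x) (hzy : z < y)
    (hxy : σ.symm x < σ.symm y) (hyz : σ.symm y < σ.symm z) :
    ∃ τ T', Peels θ w τ T' ∧ (τ.symm y).val = (τ.symm x).val + 1 ∧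
      (τ.symm z).val = (τ.symm y).val + 1 := by
  induction σ using descent_induction generalizing T with
  | h σ ih =>
    by_cases hex : ∃ m m' : Fin n, m'.val = m.val + 1 ∧ σ m' < σ m ∧ ¬ (x = σ m ∧ y = σ m') ∧
        ¬ (y = σ m ∧ z = σ m')
    · obtain ⟨m, m', hm, hd, hnxy, hnyz⟩ := hex
      exact ih m m' hm hd (h.undo hm hd) (symm_mul_swap_lt hm hxy hnxy)
        (symm_mul_swap_lt hm hyz hnyz)
    -- The only descents left are `x y` and `y z`, and there is one between `x` and `y` and
    -- one between `y` and `z`.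
    push Not at hex
    refine ⟨σ, T, h, ?_, ?_⟩
    · obtain ⟨m, m', hm, -, hle, hd⟩ := exists_descent_of_lt (f := σ) hxy (by simpa using hyx)
      by_cases hc : x = σ m ∧ y = σ m'
      · simpa [hc.1, hc.2] using hm
      · have hy := (hex m m' hm hd fun hx hy => hc ⟨hx, hy⟩).1
        rw [hy, symm_apply_apply, Fin.le_def] at hle
        omega
    · obtain ⟨m, m', hm, hle, -, hd⟩ := exists_descent_of_lt (f := σ) hyz (by simpa using hzy)
      by_cases hc : x = σ m ∧ y = σ m'
      · rw [hc.2, symm_apply_apply, Fin.le_def] at hle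
        omega
      · have hy := hex m m' hm hd fun hx hy => hc ⟨hx, hy⟩
        simpa [hy.1, hy.2] using hm

end Peels

end Peelings

section Coordinates

variable {n : ℕ} {θ : Fin n → ℝ} {σ τ : Perm (Fin n)} {m : Fin n} {y : ℝ} {p : ℂ}

/-- The height of a side labeled `i`. -/
def height (θ : Fin n → ℝ) (i : Fin n) : ℝ := -Real.sin (θ i)

/-- The horizontal displacement per unit of depth along a side labeled `i`. -/
def slope (θ : Fin n → ℝ) (i : Fin n) : ℝ := Real.cos (θ i) / height θ i

theorem Admissible.height_pos (hθ : Admissible θ) (i : Fin n) : 0 < height θ i :=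
  neg_pos.2 <| by
    have := Real.sin_pos_of_pos_of_lt_pi (x := θ i - Real.pi) (by linarith [(hθ.2 i).1])
      (by linarith [(hθ.2 i).2])
    rw [Real.sin_sub_pi] at this
    linarith

theorem Admissible.slope_strictMono (hθ : Admissible θ) : StrictMono (slope θ) := by
  intro i j hij
  have := Real.sin_pos_of_pos_of_lt_pi (x := θ j - θ i) (by linarith [hθ.1 hij])
    (by linarith [(hθ.2 i).1, (hθ.2 j).2])
  rw [Real.sin_sub] at this
  rw [slope, slope, div_lt_div_iff₀ (hθ.height_pos i) (hθ.height_pos j), height, height]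
  linarith

theorem Admissible.dir_re (hθ : Admissible θ) (i : Fin n) :
    (dir θ i).re = slope θ i * height θ i := by
  rw [slope, div_mul_cancel₀ _ (hθ.height_pos i).ne', dir, Complex.exp_ofReal_mul_I_re]

theorem dir_im (θ : Fin n → ℝ) (i : Fin n) : (dir θ i).im = -height θ i := by
  rw [height, neg_neg, dir, Complex.exp_ofReal_mul_I_im]

theorem pathVertex_zero (θ : Fin n → ℝ) (σ : Perm (Fin n)) : pathVertex θ σ 0 = 0 := by
  simp [pathVertex]

theorem pathVertex_succ (θ : Fin n → ℝ) (σ : Perm (Fin n)) (m : Fin n) :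
    pathVertex θ σ (m.val + 1) = pathVertex θ σ m.val + dir θ (σ m) := by
  have hinsert : (Finset.univ.filter fun i : Fin n => i.val < m.val + 1)
      = insert m (Finset.univ.filter fun i : Fin n => i.val < m.val) := by
    ext i
    simp only [Finset.mem_filter, Finset.mem_univ, true_and, Finset.mem_insert, Fin.ext_iff]
    omega
  rw [pathVertex, hinsert, Finset.sum_insert (by simp), add_comm, pathVertex]

theorem pathVertex_eq_sum_labels (θ : Fin n → ℝ) (σ : Perm (Fin n)) (m : ℕ) :
    pathVertex θ σ m = ∑ v : Fin n with (σ.symm v).val < m, dir θ v := by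
  rw [pathVertex, Finset.sum_filter, Finset.sum_filter,
    ← Equiv.sum_comp σ (fun v => if (σ.symm v).val < m then dir θ v else 0)]
  simp only [symm_apply_apply]

theorem pathVertex_congr (θ : Fin n → ℝ) {a b : ℕ}
    (h : ∀ v, (σ.symm v).val < a ↔ (τ.symm v).val < b) :
    pathVertex θ σ a = pathVertex θ τ b := by
  simp only [pathVertex_eq_sum_labels, h]

/-- The depth below the top vertex of the vertex number `m` of the path `σ`. -/
def depth (θ : Fin n → ℝ) (σ : Perm (Fin n)) (m : ℕ) : ℝ := -(pathVertex θ σ m).im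

theorem depth_zero (θ : Fin n → ℝ) (σ : Perm (Fin n)) : depth θ σ 0 = 0 := by
  simp [depth, pathVertex_zero]

theorem depth_succ (θ : Fin n → ℝ) (σ : Perm (Fin n)) (m : Fin n) :
    depth θ σ (m.val + 1) = depth θ σ m.val + height θ (σ m) := by
  rw [depth, depth, pathVertex_succ, Complex.add_im, dir_im, neg_add, neg_neg]

theorem depth_eq_sum (θ : Fin n → ℝ) (σ : Perm (Fin n)) (m : ℕ) :
    depth θ σ m = ∑ i : Fin n with i.val < m, height θ (σ i) := by
  simp [depth, pathVertex, dir_im]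

theorem depth_mono (hθ : Admissible θ) (σ : Perm (Fin n)) : Monotone (depth θ σ) := by
  intro a b hab
  rw [depth_eq_sum, depth_eq_sum]
  refine Finset.sum_le_sum_of_subset_of_nonneg ?_ fun i _ _ => (hθ.height_pos _).le
  exact Finset.monotone_filter_right _ fun i _ hi => hi.trans_le hab

theorem depth_lt_depth_succ (hθ : Admissible θ) (σ : Perm (Fin n)) (m : Fin n) :
    depth θ σ m.val < depth θ σ (m.val + 1) := by
  rw [depth_succ]
  linarith [hθ.height_pos (σ m)]

theorem depth_card (θ : Fin n → ℝ) (σ : Perm (Fin n)) : depth θ σ n = ∑ i, height θ i := by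
  rw [depth_eq_sum, ← Equiv.sum_comp σ]
  simp

theorem depth_mem_Icc (hθ : Admissible θ) (σ : Perm (Fin n)) {j : ℕ} (hj : j ≤ n) :
    depth θ σ j ∈ Icc 0 (∑ i, height θ i) := by
  rw [← depth_zero θ σ, ← depth_card θ σ]
  exact ⟨depth_mono hθ σ (Nat.zero_le _), depth_mono hθ σ hj⟩

theorem exists_mem_Icc_depth (hθ : Admissible θ) (hn : 0 < n) (σ : Perm (Fin n))
    (hy : y ∈ Icc 0 (∑ i, height θ i)) :
    ∃ m : Fin n, y ∈ Icc (depth θ σ m.val) (depth θ σ (m.val + 1)) := by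
  rcases hy.1.eq_or_lt with rfl | hpos
  · refine ⟨⟨0, hn⟩, ?_⟩
    exact ⟨(depth_zero θ σ).le, (depth_mem_Icc hθ σ (Nat.succ_le_of_lt hn)).1⟩
  · have hmem : y ∈ Ioc (depth θ σ 0) (depth θ σ n) := by
      rw [depth_zero, depth_card]
      exact ⟨hpos, hy.2⟩
    rw [← (depth_mono hθ σ).biUnion_Ico_Ioc_map_succ] at hmem
    obtain ⟨j, hj, hyj⟩ := mem_iUnion₂.1 hmem
    exact ⟨⟨j, hj.2⟩, Ioc_subset_Icc_self hyj⟩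

/-- `v` truncated to the interval `[0, h]`. -/
def clip (v h : ℝ) : ℝ := max 0 (min v h)

theorem clip_of_nonpos {v h : ℝ} (hv : v ≤ 0) : clip v h = 0 :=
  max_eq_left ((min_le_left v h).trans hv)

theorem clip_of_le {v h : ℝ} (h0 : 0 ≤ h) (hv : h ≤ v) : clip v h = h := by
  rw [clip, min_eq_right hv, max_eq_right h0]

theorem clip_of_mem {v h : ℝ} (hv : v ∈ Icc 0 h) : clip v h = v := by
  rw [clip, min_eq_left hv.2, max_eq_right hv.1]

/-- The horizontal coordinate of the point of the path `σ` at depth `y`, written as the sum of the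
horizontal displacements along the parts of its sides above that depth. -/
def abscissa (θ : Fin n → ℝ) (σ : Perm (Fin n)) (y : ℝ) : ℝ :=
  ∑ m : Fin n, slope θ (σ m) * clip (y - depth θ σ m.val) (height θ (σ m))

@[fun_prop]
theorem continuous_abscissa (θ : Fin n → ℝ) (σ : Perm (Fin n)) : Continuous (abscissa θ σ) := by
  unfold abscissa clip
  fun_prop

theorem abscissa_of_mem_Icc (hθ : Admissible θ)
    (hy : y ∈ Icc (depth θ σ m.val) (depth θ σ (m.val + 1))) :
    abscissa θ σ y = (pathVertex θ σ m.val).re + slope θ (σ m) * (y - depth θ σ m.val) := by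
  have hre : (pathVertex θ σ m.val).re
      = ∑ l : Fin n, if l < m then slope θ (σ l) * height θ (σ l) else 0 := by
    rw [pathVertex, Complex.re_sum, Finset.sum_filter]
    simp only [hθ.dir_re, Fin.lt_def]
  have hm : slope θ (σ m) * (y - depth θ σ m.val)
      = ∑ l : Fin n, if l = m then slope θ (σ l) * (y - depth θ σ l.val) else 0 := by
    simp
  rw [hre, hm, ← Finset.sum_add_distrib, abscissa]
  refine Finset.sum_congr rfl fun l _ => ?_
  rcases lt_trichotomy l m with hlm | rfl | hml
  · have hl := (depth_succ θ σ l).ge.trans (depth_mono hθ σ (Nat.succ_le_of_lt hlm))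
    rw [if_pos hlm, if_neg hlm.ne, add_zero,
      clip_of_le (hθ.height_pos _).le (by linarith [hy.1])]
  · have hl := depth_succ θ σ l
    rw [if_neg (lt_irrefl _), if_pos rfl, zero_add,
      clip_of_mem ⟨by linarith [hy.1], by linarith [hy.2]⟩]
  · have hl := hy.2.trans (depth_mono hθ σ (Nat.succ_le_of_lt hml))
    rw [if_neg hml.not_gt, if_neg hml.ne', clip_of_nonpos (by linarith), mul_zero, add_zero]

theorem abscissa_of_nonpos (hθ : Admissible θ) (σ : Perm (Fin n)) (hy : y ≤ 0) :
    abscissa θ σ y = 0 := by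
  refine Finset.sum_eq_zero fun m _ => ?_
  rw [clip_of_nonpos (by linarith [(depth_mem_Icc hθ σ m.isLt.le).1]), mul_zero]

theorem abscissa_of_sum_height_le (hθ : Admissible θ) (σ : Perm (Fin n))
    (hy : ∑ i, height θ i ≤ y) : abscissa θ σ y = ∑ i, slope θ i * height θ i := by
  rw [← Equiv.sum_comp σ]
  refine Finset.sum_congr rfl fun m _ => ?_
  have hm := (depth_mem_Icc hθ σ (Nat.succ_le_of_lt m.isLt)).2
  rw [Nat.succ_eq_add_one, depth_succ] at hm
  rw [clip_of_le (hθ.height_pos _).le (by linarith)]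

theorem mem_Icc_of_abscissa_ne (hθ : Admissible θ) (h : abscissa θ σ y ≠ abscissa θ τ y) :
    y ∈ Icc 0 (∑ i, height θ i) := by
  by_contra hy
  rcases not_and_or.1 hy with hy | hy
  · rw [abscissa_of_nonpos hθ σ (not_le.1 hy).le, abscissa_of_nonpos hθ τ (not_le.1 hy).le] at h
    exact h rfl
  · rw [abscissa_of_sum_height_le hθ σ (not_le.1 hy).le,
      abscissa_of_sum_height_le hθ τ (not_le.1 hy).le] at h
    exact h rfl

theorem abscissa_injective (hθ : Admissible θ) : Function.Injective (abscissa θ) := by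
  intro σ τ h
  refine Equiv.ext fun m => ?_
  induction m using WellFoundedLT.induction with
  | ind m ih =>
    have hp : pathVertex θ σ m.val = pathVertex θ τ m.val :=
      Finset.sum_congr rfl fun l hl => by rw [ih l (Finset.mem_filter.1 hl).2]
    have hd : depth θ σ m.val = depth θ τ m.val := by rw [depth, depth, hp]
    obtain ⟨y, hy, hy'⟩ := exists_between
      (lt_min (depth_lt_depth_succ hθ σ m) (hd.trans_lt (depth_lt_depth_succ hθ τ m)))
    have hXy := congrFun h y
    rw [abscissa_of_mem_Icc hθ ⟨hy.le, (lt_min_iff.1 hy').1.le⟩,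
      abscissa_of_mem_Icc hθ ⟨(hd.symm.trans_lt hy).le, (lt_min_iff.1 hy').2.le⟩, hp, hd] at hXy
    exact hθ.slope_strictMono.injective
      (mul_right_cancel₀ (sub_pos.2 (hd.symm.trans_lt hy)).ne' (add_left_cancel hXy))

theorem mem_pathEdge (hθ : Admissible θ) :
    p ∈ pathEdge θ σ m ↔ -p.im ∈ Icc (depth θ σ m.val) (depth θ σ (m.val + 1)) ∧
      p.re = abscissa θ σ (-p.im) := by
  have hh := hθ.height_pos (σ m)
  have key : p ∈ pathEdge θ σ m ↔ -p.im ∈ Icc (depth θ σ m.val) (depth θ σ (m.val + 1)) ∧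
      p.re = (pathVertex θ σ m.val).re + slope θ (σ m) * (-p.im - depth θ σ m.val) := by
    rw [pathEdge, depth_succ, pathVertex_succ, segment_eq_image']
    simp only [add_sub_cancel_left, mem_image, mem_Icc, Complex.ext_iff, Complex.add_re,
      Complex.add_im, Complex.smul_re, Complex.smul_im, hθ.dir_re, dir_im, depth, smul_eq_mul]
    constructor
    · rintro ⟨t, ⟨ht0, ht1⟩, hre, him⟩
      rw [← hre, ← him]
      exact ⟨⟨by nlinarith, by nlinarith⟩, by ring⟩
    · rintro ⟨⟨hy0, hy1⟩, hre⟩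
      refine ⟨(-p.im + (pathVertex θ σ m.val).im) / height θ (σ m),
        ⟨div_nonneg (by linarith) hh.le, (div_le_one hh).2 (by linarith)⟩, ?_, ?_⟩
      · rw [hre]
        field_simp
        ring
      · field_simp
        ring
  rw [key]
  refine and_congr_right fun hy => ?_
  rw [abscissa_of_mem_Icc hθ hy]

theorem mem_iUnion_pathEdge (hθ : Admissible θ) (hn : 0 < n) :
    p ∈ ⋃ m, pathEdge θ σ m ↔
      -p.im ∈ Icc 0 (∑ i, height θ i) ∧ p.re = abscissa θ σ (-p.im) := by
  simp only [mem_iUnion, mem_pathEdge hθ, exists_and_right]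
  refine and_congr_left fun _ => ⟨fun ⟨m, hm⟩ => ?_, exists_mem_Icc_depth hθ hn σ⟩
  exact ⟨(depth_mem_Icc hθ σ m.isLt.le).1.trans hm.1,
    hm.2.trans (depth_mem_Icc hθ σ (Nat.succ_le_of_lt m.isLt)).2⟩

end Coordinates

section Regions

/-- The points of the plane that lie, at their depth `y`, between the abscissas `f y` and `g y`. -/
def between (f g : ℝ → ℝ) : Set ℂ := {p | p.re ∈ Icc (f (-p.im)) (g (-p.im))}

section Between

variable {f g : ℝ → ℝ} {S : Set ℂ} {p : ℂ}

theorem mem_between : p ∈ between f g ↔ f (-p.im) ≤ p.re ∧ p.re ≤ g (-p.im) := Iff.rfl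

theorem isClosed_between (hf : Continuous f) (hg : Continuous g) : IsClosed (between f g) :=
  (isClosed_le (by fun_prop) Complex.continuous_re).inter
    (isClosed_le Complex.continuous_re (by fun_prop))

theorem mem_interior_between (hf : Continuous f) (hg : Continuous g) (hfp : f (-p.im) < p.re)
    (hgp : p.re < g (-p.im)) : p ∈ interior (between f g) :=
  mem_interior.2 ⟨{q | f (-q.im) < q.re} ∩ {q | q.re < g (-q.im)},
    fun _ hq => ⟨hq.1.le, hq.2.le⟩,
    (isOpen_lt (by fun_prop) Complex.continuous_re).inter
      (isOpen_lt Complex.continuous_re (by fun_prop)), hfp, hgp⟩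

theorem lt_re_of_mem_interior (hS : ∀ q ∈ S, f (-q.im) ≤ q.re) (hp : p ∈ interior S) :
    f (-p.im) < p.re := by
  obtain ⟨ε, hε, hball⟩ := Metric.isOpen_iff.1 isOpen_interior p hp
  have hq : p - ((ε / 2 : ℝ) : ℂ) ∈ S := by
    refine interior_subset (hball ?_)
    rw [Metric.mem_ball, dist_eq_norm, sub_sub_cancel_left, norm_neg, Complex.norm_real,
      Real.norm_of_nonneg (half_pos hε).le]
    exact half_lt_self hε
  have := hS _ hq
  simp only [Complex.sub_im, Complex.ofReal_im, sub_zero, Complex.sub_re, Complex.ofReal_re] at this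
  linarith

end Between

variable {n : ℕ} {θ : Fin n → ℝ}

/-- The closed region between the path `σ` on its left and the path `τ` on its right. -/
def region (θ : Fin n → ℝ) (σ τ : Perm (Fin n)) : Set ℂ :=
  {p | -p.im ∈ Icc 0 (∑ i, height θ i)} ∩ between (abscissa θ σ) (abscissa θ τ)

theorem polygon_eq_region (hθ : Admissible θ) (hn : 0 < n) (w : Perm (Fin n)) :
    polygon θ w = region θ 1 w := by
  ext p
  simp only [polygon, mem_ofPred_eq, leftBoundary, rightBoundary, leftEdge,
    mem_iUnion_pathEdge hθ hn]
  constructor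
  · rintro ⟨l, ⟨hl, hlre⟩, r, ⟨-, hrre⟩, hlim, hrim, hlp, hpr⟩
    rw [hlim] at hl hlre
    rw [hrim] at hrre
    exact ⟨hl, hlre ▸ hlp, hrre ▸ hpr⟩
  · rintro ⟨hp, hlp, hpr⟩
    exact ⟨⟨abscissa θ 1 (-p.im), p.im⟩, ⟨hp, rfl⟩, ⟨abscissa θ w (-p.im), p.im⟩, ⟨hp, rfl⟩, rfl,
      rfl, hlp, hpr⟩

end Regions

namespace Tile

variable {n : ℕ} {θ : Fin n → ℝ} {t : Tile n} {y : ℝ} {p : ℂ}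

/-- The depth of the top vertex of a tile. -/
def start (t : Tile n) : ℝ := -t.top.im

/-- The depth of the left vertex of a tile. -/
def mid (θ : Fin n → ℝ) (t : Tile n) : ℝ := t.start + height θ t.i

/-- The depth of the bottom vertex of a tile. -/
def finish (θ : Fin n → ℝ) (t : Tile n) : ℝ := t.start + (height θ t.i + height θ t.j)

/-- The abscissa of the left side of a tile at depth `y`. It is the maximum of the two affine
functions whose graphs contain the edges of that side, because the slope increases with the
label. -/
def left (θ : Fin n → ℝ) (t : Tile n) (y : ℝ) : ℝ :=
  t.top.re + max (slope θ t.i * (y - t.start))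
    (slope θ t.i * height θ t.i + slope θ t.j * (y - t.mid θ))

/-- The abscissa of the right side of a tile at depth `y`. -/
def right (θ : Fin n → ℝ) (t : Tile n) (y : ℝ) : ℝ :=
  t.top.re + min (slope θ t.j * (y - t.start))
    (slope θ t.j * height θ t.j + slope θ t.i * (y - (t.start + height θ t.j)))

@[fun_prop]
theorem continuous_left (θ : Fin n → ℝ) (t : Tile n) : Continuous (t.left θ) := by
  unfold left
  fun_prop

@[fun_prop]
theorem continuous_right (θ : Fin n → ℝ) (t : Tile n) : Continuous (t.right θ) := by
  unfold right
  fun_prop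

theorem start_lt_mid (hθ : Admissible θ) (t : Tile n) : t.start < t.mid θ :=
  lt_add_of_pos_right _ (hθ.height_pos _)

theorem mid_lt_finish (hθ : Admissible θ) (t : Tile n) : t.mid θ < t.finish θ := by
  rw [mid, finish]
  linarith [hθ.height_pos t.j]

theorem slope_lt (hθ : Admissible θ) (t : Tile n) : slope θ t.i < slope θ t.j :=
  hθ.slope_strictMono t.lt

theorem left_of_le_mid (hθ : Admissible θ) (hy : y ≤ t.mid θ) :
    t.left θ y = t.top.re + slope θ t.i * (y - t.start) := by
  rw [left, max_eq_left]
  rw [mid] at hy ⊢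
  nlinarith [t.slope_lt hθ]

theorem left_of_mid_le (hθ : Admissible θ) (hy : t.mid θ ≤ y) :
    t.left θ y = t.top.re + (slope θ t.i * height θ t.i + slope θ t.j * (y - t.mid θ)) := by
  rw [left, max_eq_right]
  rw [mid] at hy ⊢
  nlinarith [t.slope_lt hθ]

theorem right_of_le (hθ : Admissible θ) (hy : y ≤ t.start + height θ t.j) :
    t.right θ y = t.top.re + slope θ t.j * (y - t.start) := by
  rw [right, min_eq_left]
  nlinarith [t.slope_lt hθ]

theorem right_of_ge (hθ : Admissible θ) (hy : t.start + height θ t.j ≤ y) :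
    t.right θ y = t.top.re +
      (slope θ t.j * height θ t.j + slope θ t.i * (y - (t.start + height θ t.j))) := by
  rw [right, min_eq_right]
  nlinarith [t.slope_lt hθ]

theorem left_lt_right (hθ : Admissible θ) (hy : y ∈ Ioo t.start (t.finish θ)) :
    t.left θ y < t.right θ y := by
  have hs := sub_pos.2 (t.slope_lt hθ)
  have hstart := mul_pos hs (sub_pos.2 hy.1)
  have hfinish := mul_pos hs (sub_pos.2 hy.2)
  have hi := mul_pos hs (hθ.height_pos t.i)
  have hj := mul_pos hs (hθ.height_pos t.j)
  rw [left, right, add_lt_add_iff_left, max_lt_iff, lt_min_iff, lt_min_iff]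
  rw [finish] at hfinish
  rw [mid]
  refine ⟨⟨?_, ?_⟩, ?_, ?_⟩ <;> linarith

theorem left_le_right (hθ : Admissible θ) (hy : y ∈ Icc t.start (t.finish θ)) :
    t.left θ y ≤ t.right θ y := by
  have hne := ((t.start_lt_mid hθ).trans (t.mid_lt_finish hθ)).ne
  refine le_on_closure (f := t.left θ) (g := t.right θ) (fun z hz => (left_lt_right hθ hz).le)
    (by fun_prop) (by fun_prop) ?_
  rwa [closure_Ioo hne]

theorem mem_carrier_iff_coords (hθ : Admissible θ) :
    p ∈ t.carrier θ ↔ ∃ a ∈ Icc (0 : ℝ) 1, ∃ b ∈ Icc (0 : ℝ) 1,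
      p.re - t.top.re = slope θ t.i * height θ t.i * a + slope θ t.j * height θ t.j * b ∧
      -p.im - t.start = height θ t.i * a + height θ t.j * b := by
  simp only [carrier, mem_ofPred_eq, Complex.ext_iff, Complex.add_re, Complex.add_im,
    Complex.re_ofReal_mul, Complex.im_ofReal_mul, hθ.dir_re, dir_im, start]
  refine exists_congr fun a => and_congr_right fun _ => exists_congr fun b =>
    and_congr_right fun _ => and_congr ?_ ?_ <;>
  constructor <;> intro h <;> linarith

theorem depth_mem_Icc (hθ : Admissible θ) (hp : p ∈ t.carrier θ) :
    -p.im ∈ Icc t.start (t.finish θ) := by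
  obtain ⟨a, ⟨ha0, ha1⟩, b, ⟨hb0, hb1⟩, -, hy⟩ := (mem_carrier_iff_coords hθ).1 hp
  have hi := hθ.height_pos t.i
  have hj := hθ.height_pos t.j
  constructor
  · nlinarith
  · rw [finish]
    nlinarith

theorem carrier_eq_between (hθ : Admissible θ) (t : Tile n) :
    t.carrier θ = between (t.left θ) (t.right θ) := by
  ext p
  have hs := sub_pos.2 (t.slope_lt hθ)
  have hi := mul_pos hs (hθ.height_pos t.i)
  have hj := mul_pos hs (hθ.height_pos t.j)
  rw [mem_carrier_iff_coords hθ, mem_between, left, right, mid, ← le_sub_iff_add_le',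
    ← sub_le_iff_le_add', max_le_iff, le_min_iff]
  constructor
  · rintro ⟨a, ⟨ha0, ha1⟩, b, ⟨hb0, hb1⟩, hx, hy⟩
    have ha := mul_nonneg hi.le ha0
    have ha' := mul_nonneg hi.le (sub_nonneg.2 ha1)
    have hb := mul_nonneg hj.le hb0
    have hb' := mul_nonneg hj.le (sub_nonneg.2 hb1)
    rw [hx, ← sub_sub, ← sub_sub, hy]
    refine ⟨⟨?_, ?_⟩, ?_, ?_⟩ <;> linarith
  · rintro ⟨⟨hil, hjl⟩, hjr, hir⟩
    -- Cramer's rule for the coordinates along the two edge directions.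
    refine ⟨(slope θ t.j * (-p.im - t.start) - (p.re - t.top.re)) /
        ((slope θ t.j - slope θ t.i) * height θ t.i),
      ⟨div_nonneg (by linarith) hi.le, (div_le_one hi).2 (by linarith)⟩,
      ((p.re - t.top.re) - slope θ t.i * (-p.im - t.start)) /
        ((slope θ t.j - slope θ t.i) * height θ t.j),
      ⟨div_nonneg (by linarith) hj.le, (div_le_one hj).2 (by linarith)⟩, ?_, ?_⟩ <;>
    · have := hs.ne'
      have := (hθ.height_pos t.i).ne'
      have := (hθ.height_pos t.j).ne'
      field_simp
      ring

theorem isClosed_carrier (hθ : Admissible θ) (t : Tile n) : IsClosed (t.carrier θ) := by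
  rw [carrier_eq_between hθ]
  exact isClosed_between (t.continuous_left θ) (t.continuous_right θ)

theorem mem_interior_carrier (hθ : Admissible θ) (hl : t.left θ (-p.im) < p.re)
    (hr : p.re < t.right θ (-p.im)) : p ∈ interior (t.carrier θ) := by
  rw [carrier_eq_between hθ]
  exact mem_interior_between (t.continuous_left θ) (t.continuous_right θ) hl hr

theorem convex_carrier (θ : Fin n → ℝ) (t : Tile n) : Convex ℝ (t.carrier θ) := by
  rintro _ ⟨a, ha, b, hb, rfl⟩ _ ⟨a', ha', b', hb', rfl⟩ r s hr hs hrs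
  refine ⟨r * a + s * a', convex_Icc 0 1 ha ha' hr hs hrs, r * b + s * b',
    convex_Icc 0 1 hb hb' hr hs hrs, ?_⟩
  have hrs' : (r : ℂ) + s = 1 := by exact_mod_cast hrs
  simp only [Complex.real_smul, Complex.ofReal_add, Complex.ofReal_mul]
  linear_combination t.top * hrs'

theorem carrier_subset_closure_interior (hθ : Admissible θ) (t : Tile n) :
    t.carrier θ ⊆ closure (interior (t.carrier θ)) := by
  have hy : t.mid θ ∈ Ioo t.start (t.finish θ) := ⟨t.start_lt_mid hθ, t.mid_lt_finish hθ⟩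
  obtain ⟨x, hxl, hxr⟩ := exists_between (left_lt_right hθ hy)
  have hne : (interior (t.carrier θ)).Nonempty :=
    ⟨⟨x, -t.mid θ⟩, mem_interior_carrier hθ (by simpa using hxl) (by simpa using hxr)⟩
  rw [(t.convex_carrier θ).closure_interior_eq_closure_of_nonempty_interior hne]
  exact subset_closure

end Tile

section Corner

variable {n : ℕ} {θ : Fin n → ℝ} {σ : Perm (Fin n)} {m m' : Fin n} {y : ℝ} {p : ℂ}

theorem pathVertex_mul_swap (θ : Fin n → ℝ) (σ : Perm (Fin n)) (hm : m'.val = m.val + 1) {j : ℕ}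
    (hj : j ≠ m'.val) : pathVertex θ (σ * swap m m') j = pathVertex θ σ j := by
  refine pathVertex_congr θ fun v => ?_
  rw [symm_mul_swap_apply]
  simp only [swap_apply_def, Fin.ext_iff]
  split_ifs <;> omega

theorem depth_mul_swap (θ : Fin n → ℝ) (σ : Perm (Fin n)) (hm : m'.val = m.val + 1) {j : ℕ}
    (hj : j ≠ m'.val) : depth θ (σ * swap m m') j = depth θ σ j := by
  rw [depth, depth, pathVertex_mul_swap θ σ hm hj]

theorem depth_mul_swap_self (θ : Fin n → ℝ) (σ : Perm (Fin n)) (hm : m'.val = m.val + 1) :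
    depth θ (σ * swap m m') m'.val = depth θ σ m.val + height θ (σ m') := by
  rw [hm, depth_succ, depth_mul_swap θ σ hm (by omega), Perm.mul_apply, swap_apply_left]

theorem start_cornerTile (h : σ m < σ m') : (cornerTile θ σ m m' h).start = depth θ σ m.val := rfl

theorem mid_cornerTile (hm : m'.val = m.val + 1) (h : σ m < σ m') :
    (cornerTile θ σ m m' h).mid θ = depth θ σ m'.val := by
  rw [hm, depth_succ]
  rfl

theorem finish_cornerTile (hm : m'.val = m.val + 1) (h : σ m < σ m') :
    (cornerTile θ σ m m' h).finish θ = depth θ σ (m'.val + 1) := by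
  rw [depth_succ, hm, depth_succ, add_assoc]
  rfl

theorem left_cornerTile (hθ : Admissible θ) (hm : m'.val = m.val + 1) (h : σ m < σ m')
    (hy : y ∈ Icc (depth θ σ m.val) (depth θ σ (m'.val + 1))) :
    (cornerTile θ σ m m' h).left θ y = abscissa θ σ y := by
  have hmid := mid_cornerTile (θ := θ) hm h
  rcases le_total y (depth θ σ m'.val) with hle | hle
  · rw [Tile.left_of_le_mid hθ (hmid ▸ hle), abscissa_of_mem_Icc hθ ⟨hy.1, hm ▸ hle⟩]
    rfl
  · rw [Tile.left_of_mid_le hθ (hmid ▸ hle), abscissa_of_mem_Icc hθ ⟨hle, hy.2⟩, hmid, hm,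
      pathVertex_succ, Complex.add_re, hθ.dir_re, ← add_assoc]
    rfl

theorem right_cornerTile (hθ : Admissible θ) (hm : m'.val = m.val + 1) (h : σ m < σ m')
    (hy : y ∈ Icc (depth θ σ m.val) (depth θ σ (m'.val + 1))) :
    (cornerTile θ σ m m' h).right θ y = abscissa θ (σ * swap m m') y := by
  have hdm := depth_mul_swap θ σ hm (j := m.val) (by omega)
  have hpm := pathVertex_mul_swap θ σ hm (j := m.val) (by omega)
  have hdm' := depth_mul_swap_self θ σ hm
  have hdtop := depth_mul_swap θ σ hm (j := m'.val + 1) (by omega)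
  have hτm : (σ * swap m m') m = σ m' := by simp
  have hτm' : (σ * swap m m') m' = σ m := by simp
  rcases le_total y (depth θ σ m.val + height θ (σ m')) with hle | hle
  · rw [Tile.right_of_le hθ hle, abscissa_of_mem_Icc (m := m) hθ, hdm, hpm, hτm]
    · rfl
    · rw [hdm, ← hm, hdm']
      exact ⟨hy.1, hle⟩
  · rw [Tile.right_of_ge hθ hle, abscissa_of_mem_Icc (m := m') hθ, hdm', hτm', hm,
      pathVertex_succ, hpm, hτm, Complex.add_re, hθ.dir_re, ← add_assoc]
    · rfl
    · rw [hdm', hdtop]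
      exact ⟨hle, hy.2⟩

theorem abscissa_mul_swap_of_notMem (hθ : Admissible θ) (hm : m'.val = m.val + 1)
    (hy : y ∉ Ioo (depth θ σ m.val) (depth θ σ (m'.val + 1))) :
    abscissa θ (σ * swap m m') y = abscissa θ σ y := by
  rw [abscissa, ← Equiv.sum_comp (swap m m')]
  refine Finset.sum_congr rfl fun l _ => ?_
  rw [Perm.mul_apply, swap_apply_self]
  have hi := hθ.height_pos (σ m)
  have hj := hθ.height_pos (σ m')
  have hdm' := depth_succ θ σ m
  have hdtop := depth_succ θ σ m'
  have hy : y ≤ depth θ σ m.val ∨ depth θ σ m'.val + height θ (σ m') ≤ y := by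
    rwa [mem_Ioo, not_and_or, not_lt, not_lt, hdtop] at hy
  rw [← hm] at hdm'
  rcases eq_or_ne l m with rfl | hlm
  · rw [swap_apply_left, depth_mul_swap_self θ σ hm]
    rcases hy with hy | hy
    · rw [clip_of_nonpos (by linarith), clip_of_nonpos (by linarith)]
    · rw [clip_of_le hi.le (by linarith), clip_of_le hi.le (by linarith)]
  rcases eq_or_ne l m' with rfl | hlm'
  · rw [swap_apply_right, depth_mul_swap θ σ hm (by omega)]
    rcases hy with hy | hy
    · rw [clip_of_nonpos (by linarith), clip_of_nonpos (by linarith)]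
    · rw [clip_of_le hj.le (by linarith), clip_of_le hj.le (by linarith)]
  · rw [swap_apply_of_ne_of_ne hlm hlm', depth_mul_swap θ σ hm (Fin.val_ne_of_ne hlm')]

theorem mem_Ioo_of_abscissa_lt_mul_swap (hθ : Admissible θ) (hm : m'.val = m.val + 1)
    (hy : abscissa θ σ y < abscissa θ (σ * swap m m') y) :
    y ∈ Ioo (depth θ σ m.val) (depth θ σ (m'.val + 1)) :=
  not_not.1 fun h => hy.ne' (abscissa_mul_swap_of_notMem hθ hm h)

theorem abscissa_le_mul_swap (hθ : Admissible θ) (hm : m'.val = m.val + 1) (h : σ m < σ m')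
    (y : ℝ) : abscissa θ σ y ≤ abscissa θ (σ * swap m m') y := by
  by_cases hy : y ∈ Ioo (depth θ σ m.val) (depth θ σ (m'.val + 1))
  · have hy' := Ioo_subset_Icc_self hy
    rw [← left_cornerTile hθ hm h hy', ← right_cornerTile hθ hm h hy']
    exact Tile.left_le_right hθ (by rwa [finish_cornerTile hm h, start_cornerTile])
  · exact (abscissa_mul_swap_of_notMem hθ hm hy).ge

theorem mem_carrier_cornerTile (hθ : Admissible θ) (hm : m'.val = m.val + 1) (h : σ m < σ m') :
    p ∈ (cornerTile θ σ m m' h).carrier θ ↔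
      -p.im ∈ Icc (depth θ σ m.val) (depth θ σ (m'.val + 1)) ∧
        p ∈ between (abscissa θ σ) (abscissa θ (σ * swap m m')) := by
  have key : -p.im ∈ Icc (depth θ σ m.val) (depth θ σ (m'.val + 1)) →
      (p ∈ (cornerTile θ σ m m' h).carrier θ ↔
        p ∈ between (abscissa θ σ) (abscissa θ (σ * swap m m'))) := fun hy => by
    rw [Tile.carrier_eq_between hθ, mem_between, left_cornerTile hθ hm h hy,
      right_cornerTile hθ hm h hy, mem_between]
  refine ⟨fun hp => ?_, fun hp => (key hp.1).2 hp.2⟩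
  have hy := Tile.depth_mem_Icc hθ hp
  rw [finish_cornerTile hm h, start_cornerTile] at hy
  exact ⟨hy, (key hy).1 hp⟩

theorem mem_interior_cornerTile (hθ : Admissible θ) (hm : m'.val = m.val + 1) (h : σ m < σ m')
    (hl : abscissa θ σ (-p.im) < p.re) (hr : p.re < abscissa θ (σ * swap m m') (-p.im)) :
    p ∈ interior ((cornerTile θ σ m m' h).carrier θ) := by
  have hy := Ioo_subset_Icc_self (mem_Ioo_of_abscissa_lt_mul_swap hθ hm (hl.trans hr))
  refine Tile.mem_interior_carrier hθ ?_ ?_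
  · rwa [left_cornerTile hθ hm h hy]
  · rwa [right_cornerTile hθ hm h hy]

end Corner

section PartialTilings

variable {n : ℕ} {θ : Fin n → ℝ} {w σ : Perm (Fin n)} {T : Set (Tile n)} {m m' : Fin n}

/-- `T` tiles the region between the path `σ` and the path `w`. The cover is only asked to contain
the points that lie strictly to the right of `σ`: where the two paths meet, the region is a segment
that no tile has to contain. -/
structure IsPartialTiling (θ : Fin n → ℝ) (w σ : Perm (Fin n)) (T : Set (Tile n)) : Prop where
  finite : T.Finite
  le : abscissa θ σ ≤ abscissa θ w
  subset : ∀ t ∈ T, t.carrier θ ⊆ region θ σ w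
  cover : ∀ p : ℂ, abscissa θ σ (-p.im) < p.re → p.re ≤ abscissa θ w (-p.im) →
    ∃ t ∈ T, p ∈ t.carrier θ
  disjoint : ∀ s ∈ T, ∀ t ∈ T, s ≠ t → Disjoint (interior (s.carrier θ)) (interior (t.carrier θ))

theorem carrier_cornerTile_subset_region (hθ : Admissible θ) (hm : m'.val = m.val + 1)
    (h : σ m < σ m') : (cornerTile θ σ m m' h).carrier θ ⊆ region θ σ (σ * swap m m') := by
  intro p hp
  obtain ⟨hy, hp⟩ := (mem_carrier_cornerTile hθ hm h).1 hp
  exact ⟨⟨(depth_mem_Icc hθ σ m.isLt.le).1.trans hy.1,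
    hy.2.trans (depth_mem_Icc hθ σ (Nat.succ_le_of_lt m'.isLt)).2⟩, hp⟩

namespace IsPartialTiling

theorem refl (θ : Fin n → ℝ) (w : Perm (Fin n)) : IsPartialTiling θ w w ∅ where
  finite := finite_empty
  le := le_rfl
  subset _ ht := ht.elim
  cover _ hσ hw := (hσ.not_ge hw).elim
  disjoint _ hs := hs.elim

theorem disjoint_interior_cornerTile (hθ : Admissible θ) (hm : m'.val = m.val + 1)
    (hlt : σ m < σ m') (h : IsPartialTiling θ w (σ * swap m m') T) {t : Tile n} (ht : t ∈ T) :
    Disjoint (interior ((cornerTile θ σ m m' hlt).carrier θ)) (interior (t.carrier θ)) := by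
  refine disjoint_left.2 fun p hp hpt => ?_
  have hle := ((mem_carrier_cornerTile hθ hm hlt).1 (interior_subset hp)).2.2
  exact (lt_re_of_mem_interior (fun q hq => (h.subset t ht hq).2.1) hpt).not_ge hle

theorem insert_cornerTile (hθ : Admissible θ) (hm : m'.val = m.val + 1) (hlt : σ m < σ m')
    (h : IsPartialTiling θ w (σ * swap m m') T) :
    IsPartialTiling θ w σ (insert (cornerTile θ σ m m' hlt) T) where
  finite := h.finite.insert _
  le y := (abscissa_le_mul_swap hθ hm hlt y).trans (h.le y)
  subset t ht p hp := by
    rcases ht with rfl | ht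
    · obtain ⟨hy, hl, hr⟩ := carrier_cornerTile_subset_region hθ hm hlt hp
      exact ⟨hy, hl, hr.trans (h.le _)⟩
    · obtain ⟨hy, hl, hr⟩ := h.subset t ht hp
      exact ⟨hy, (abscissa_le_mul_swap hθ hm hlt _).trans hl, hr⟩
  cover p hσ hw := by
    rcases lt_or_ge (abscissa θ (σ * swap m m') (-p.im)) p.re with hlt' | hle
    · obtain ⟨t, ht, htp⟩ := h.cover p hlt' hw
      exact ⟨t, mem_insert_of_mem _ ht, htp⟩
    · have hy := mem_Ioo_of_abscissa_lt_mul_swap hθ hm (hσ.trans_le hle)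
      exact ⟨_, mem_insert _ _, (mem_carrier_cornerTile hθ hm hlt).2
        ⟨Ioo_subset_Icc_self hy, hσ.le, hle⟩⟩
  disjoint s hs t ht hst := by
    rcases hs with rfl | hs <;> rcases ht with rfl | ht
    · exact (hst rfl).elim
    · exact h.disjoint_interior_cornerTile hθ hm hlt ht
    · exact (h.disjoint_interior_cornerTile hθ hm hlt hs).symm
    · exact h.disjoint s hs t ht hst

theorem abscissa_mul_swap_le_re (hθ : Admissible θ) (h : IsPartialTiling θ w σ T)
    (hm : m'.val = m.val + 1) (hlt : σ m < σ m') (hc : cornerTile θ σ m m' hlt ∈ T) {t : Tile n}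
    (ht : t ∈ T) (hne : t ≠ cornerTile θ σ m m' hlt) {p : ℂ} (hp : p ∈ t.carrier θ) :
    abscissa θ (σ * swap m m') (-p.im) ≤ p.re := by
  have hclosed : IsClosed {q : ℂ | abscissa θ (σ * swap m m') (-q.im) ≤ q.re} :=
    isClosed_le (by fun_prop) Complex.continuous_re
  refine closure_minimal (fun q hq => ?_) hclosed (t.carrier_subset_closure_interior hθ hp)
  by_contra hlt'
  have hσ := lt_re_of_mem_interior (fun q hq => (h.subset t ht hq).2.1) hq
  exact disjoint_left.1 (h.disjoint t ht _ hc hne) hq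
    (mem_interior_cornerTile hθ hm hlt hσ (not_le.1 hlt'))

theorem sdiff_cornerTile (hθ : Admissible θ) (h : IsPartialTiling θ w σ T)
    (hm : m'.val = m.val + 1) (hlt : σ m < σ m') (hc : cornerTile θ σ m m' hlt ∈ T) :
    IsPartialTiling θ w (σ * swap m m') (T \ {cornerTile θ σ m m' hlt}) where
  finite := h.finite.sdiff
  le y := by
    by_cases hy : y ∈ Ioo (depth θ σ m.val) (depth θ σ (m'.val + 1))
    · have hp : (⟨abscissa θ (σ * swap m m') y, -y⟩ : ℂ)
          ∈ (cornerTile θ σ m m' hlt).carrier θ := by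
        rw [mem_carrier_cornerTile hθ hm hlt, mem_between, neg_neg]
        exact ⟨Ioo_subset_Icc_self hy, abscissa_le_mul_swap hθ hm hlt y, le_rfl⟩
      simpa using (h.subset _ hc hp).2.2
    · exact (abscissa_mul_swap_of_notMem hθ hm hy).trans_le (h.le y)
  subset t ht p hp :=
    ⟨(h.subset t ht.1 hp).1, h.abscissa_mul_swap_le_re hθ hm hlt hc ht.1 ht.2 hp,
      (h.subset t ht.1 hp).2.2⟩
  cover p hσ hw := by
    obtain ⟨t, ht, htp⟩ := h.cover p ((abscissa_le_mul_swap hθ hm hlt _).trans_lt hσ) hw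
    refine ⟨t, ⟨ht, ?_⟩, htp⟩
    rintro rfl
    exact hσ.not_ge ((mem_carrier_cornerTile hθ hm hlt).1 htp).2.2
  disjoint s hs t ht hst := h.disjoint s hs.1 t ht.1 hst

end IsPartialTiling

theorem Peels.isPartialTiling (hθ : Admissible θ) (h : Peels θ w σ T) :
    IsPartialTiling θ w σ T := by
  induction h with
  | refl => exact .refl θ w
  | step _ _ _ hm hlt _ _ ih => exact ih.insert_cornerTile hθ hm hlt

end PartialTilings

section FullySupported

variable {n : ℕ} {θ : Fin n → ℝ} {w σ : Perm (Fin n)} {T : Set (Tile n)} {l m m' : Fin n}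

theorem pathEdge_subset_carrier_cornerTile (hθ : Admissible θ) (hm : m'.val = m.val + 1)
    (h : σ m < σ m') (hl : l = m ∨ l = m') :
    pathEdge θ σ l ⊆ (cornerTile θ σ m m' h).carrier θ := by
  intro p hp
  obtain ⟨hy, hre⟩ := (mem_pathEdge hθ).1 hp
  have hle := hre.trans_le (abscissa_le_mul_swap hθ hm h _)
  refine (mem_carrier_cornerTile hθ hm h).2 ⟨?_, hre.ge, hle⟩
  rcases hl with rfl | rfl
  · exact ⟨hy.1, hy.2.trans (depth_mono hθ σ (by omega))⟩
  · exact ⟨(depth_mono hθ σ (by omega)).trans hy.1, hy.2⟩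

theorem Peels.pathEdge_subset (hθ : Admissible θ) (h : Peels θ w σ T)
    (hl : ¬ ∀ v, w.symm v < w.symm (σ l) ↔ σ.symm v < l) :
    pathEdge θ σ l ⊆ ⋃ t ∈ T, t.carrier θ := by
  induction h with
  | refl => simp at hl
  | step σ m m' hm hlt _ _ ih =>
    by_cases hlm : l = m ∨ l = m'
    · exact (pathEdge_subset_carrier_cornerTile hθ hm hlt hlm).trans
        (subset_biUnion_of_mem (mem_insert _ _))
    rw [not_or] at hlm
    have hpath : pathEdge θ (σ * swap m m') l = pathEdge θ σ l := by
      have hl := Fin.val_ne_of_ne hlm.1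
      have hl' := Fin.val_ne_of_ne hlm.2
      rw [pathEdge, pathEdge, pathVertex_mul_swap θ σ hm hl',
        pathVertex_mul_swap θ σ hm (by omega)]
    rw [← hpath]
    refine (ih ?_).trans (biUnion_subset_biUnion_left (subset_insert _ _))
    contrapose! hl
    intro v
    rw [Perm.mul_apply, swap_apply_of_ne_of_ne hlm.1 hlm.2] at hl
    rw [hl v, symm_mul_swap_apply]
    simp only [swap_apply_def, Fin.ext_iff, Fin.lt_def] at hlm ⊢
    split_ifs <;> omega

theorem Peels.leftEdge_subset (hθ : Admissible θ) (hn : 2 ≤ n) (hw : FullySupported w)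
    (h : Peels θ w 1 T) (l : Fin n) : leftEdge θ l ⊆ ⋃ t ∈ T, t.carrier θ := by
  refine h.pathEdge_subset hθ fun hl => hw.not_forall_lt_symm_iff_apply_lt hn l fun p => ?_
  rw [← w.symm_apply_apply p, apply_symm_apply]
  exact hl (w p)

theorem Peels.isRhombicTiling (hθ : Admissible θ) (hn : 2 ≤ n) (hw : FullySupported w)
    (h : Peels θ w 1 T) : IsRhombicTiling θ w h.finite.toFinset where
  cover := by
    have hpartial := h.isPartialTiling hθ
    simp only [Finite.mem_toFinset]
    rw [polygon_eq_region hθ (by omega)]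
    refine (iUnion₂_subset hpartial.subset).antisymm fun p ⟨hy, hl, hr⟩ => ?_
    rcases hl.eq_or_lt with heq | hlt
    · obtain ⟨l, hp⟩ := mem_iUnion.1 ((mem_iUnion_pathEdge hθ (by omega)).2 ⟨hy, heq.symm⟩)
      exact h.leftEdge_subset hθ hn hw l hp
    · obtain ⟨t, ht, htp⟩ := hpartial.cover p hlt hr
      exact mem_biUnion ht htp
  disjoint s hs t ht :=
    (h.isPartialTiling hθ).disjoint s (h.finite.mem_toFinset.1 hs) t (h.finite.mem_toFinset.1 ht)

theorem IsRhombicTiling.isPartialTiling (hθ : Admissible θ) (hn : 0 < n) {T : Finset (Tile n)}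
    (h : IsRhombicTiling θ w T) : IsPartialTiling θ w 1 (T : Set (Tile n)) where
  finite := T.finite_toSet
  le := by
    obtain ⟨T', -, hT'⟩ := (Peels.refl (θ := θ) (w := w)).exists_one
    exact (hT'.isPartialTiling hθ).le
  subset t ht := by
    rw [← polygon_eq_region hθ hn, ← h.cover]
    exact subset_biUnion_of_mem (u := fun t => Tile.carrier θ t) ht
  cover p hl hr := by
    have hp : p ∈ polygon θ w := by
      rw [polygon_eq_region hθ hn]
      exact ⟨mem_Icc_of_abscissa_ne hθ (hl.trans_le hr).ne, hl.le, hr⟩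
    rw [← h.cover] at hp
    obtain ⟨t, ht, htp⟩ := mem_iUnion₂.1 hp
    exact ⟨t, ht, htp⟩
  disjoint := h.disjoint

end FullySupported

section Covers

open Filter Topology

variable {ι : Type*} {T : Set ι} {U L : ι → Set ℝ} {V E : Set ℝ} {y : ℝ}

theorem eventually_mem_biUnion_union (hV : IsOpen V) (hE : E.Finite)
    (hcover : V \ E ⊆ ⋃ t ∈ T, U t ∪ L t) (hy : y ∈ V) :
    ∀ᶠ z in 𝓝[≠] y, z ∈ (⋃ t ∈ T, U t) ∪ ⋃ t ∈ T, L t := by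
  have hVy : ∀ᶠ z in 𝓝[≠] y, z ∈ V := nhdsWithin_le_nhds (hV.mem_nhds hy)
  have hEy : ∀ᶠ z in 𝓝[≠] y, z ∉ E := nhdsNE_le_cofinite y hE.compl_mem_cofinite
  filter_upwards [hVy, hEy] with z hzV hzE
  simpa only [iUnion_union_distrib] using hcover ⟨hzV, hzE⟩

theorem nonempty_biUnion_of_isOpen (hT : T.Finite) (hV : IsOpen V) (hne : V.Nonempty)
    (hbdd : BddAbove V) (hE : E.Finite) (hcover : V \ E ⊆ ⋃ t ∈ T, U t ∪ L t)
    (hU : ∀ t ∈ T, ∀ a ∈ U t, ∀ z ∈ closure (U t), a ≤ z → z ∈ V) : (⋃ t ∈ T, L t).Nonempty := by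
  by_contra hL
  have hev : ∀ z ∈ V, ∀ᶠ x in 𝓝[≠] z, x ∈ ⋃ t ∈ T, U t := fun z hz => by
    simpa [not_nonempty_iff_eq_empty.1 hL] using eventually_mem_biUnion_union hV hE hcover hz
  have hsub : ⋃ t ∈ T, U t ⊆ V :=
    iUnion₂_subset fun t ht a ha => hU t ht a ha a (subset_closure ha) le_rfl
  have hbddU := hbdd.mono hsub
  have hneU : (⋃ t ∈ T, U t).Nonempty := (hev _ hne.some_mem).exists
  have hsup := csSup_mem_closure hneU hbddU
  rw [hT.closure_biUnion] at hsup
  obtain ⟨t, ht, hyt⟩ := mem_iUnion₂.1 hsup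
  obtain ⟨a, ha⟩ := closure_nonempty_iff.1 ⟨_, hyt⟩
  have hyV := hU t ht a ha _ hyt (le_csSup hbddU (mem_biUnion ht ha))
  -- Just after the supremum of the sets `U t`, nothing would be left to cover `V`.
  obtain ⟨z, hzU, hz⟩ :=
    (((hev _ hyV).filter_mono (nhdsGT_le_nhdsNE _)).and self_mem_nhdsWithin).exists
  exact (le_csSup hbddU hzU).not_gt hz

theorem exists_mem_closure_of_isOpen (hT : T.Finite) (hV : IsOpen V) (hne : V.Nonempty)
    (hbdd : Bornology.IsBounded V) (hE : E.Finite) (hcover : V \ E ⊆ ⋃ t ∈ T, U t ∪ L t)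
    (hU : ∀ t ∈ T, ∀ a ∈ U t, ∀ z ∈ closure (U t), a ≤ z → z ∈ V)
    (hL : ∀ t ∈ T, ∀ a ∈ L t, ∀ z ∈ closure (L t), z ≤ a → z ∈ V) :
    ∃ y, (∃ t ∈ T, y ∈ closure (U t) ∧ ∃ a ∈ U t, a < y) ∧
      ∃ s ∈ T, y ∈ closure (L s) ∧ ∃ a ∈ L s, y ≤ a := by
  have hneL := nonempty_biUnion_of_isOpen hT hV hne hbdd.bddAbove hE hcover hU
  have hsub : ⋃ t ∈ T, L t ⊆ V :=
    iUnion₂_subset fun t ht a ha => hL t ht a ha a (subset_closure ha) le_rfl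
  have hbddL := hbdd.bddBelow.mono hsub
  have hinf := csInf_mem_closure hneL hbddL
  rw [hT.closure_biUnion] at hinf
  obtain ⟨s, hs, hys⟩ := mem_iUnion₂.1 hinf
  obtain ⟨a, ha⟩ := closure_nonempty_iff.1 ⟨_, hys⟩
  have hya := csInf_le hbddL (mem_biUnion hs ha)
  have hyV := hL s hs a ha _ hys hya
  -- Just before the infimum of the sets `L t`, only the sets `U t` are left to cover `V`.
  have hyU : sInf (⋃ t ∈ T, L t) ∈ closure (⋃ t ∈ T, U t ∩ Iio (sInf (⋃ t ∈ T, L t))) := by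
    refine mem_closure_iff_frequently.2 (Eventually.frequently ?_ |>.filter_mono
      (nhdsWithin_le_nhds (s := Iio (sInf (⋃ t ∈ T, L t)))))
    filter_upwards [(eventually_mem_biUnion_union hV hE hcover hyV).filter_mono
      (nhdsLT_le_nhdsNE _), self_mem_nhdsWithin] with z hz hzy
    have hzL : z ∉ ⋃ t ∈ T, L t := fun hzL => (csInf_le hbddL hzL).not_gt hzy
    obtain ⟨t, ht, hzt⟩ := mem_iUnion₂.1 (hz.resolve_right hzL)
    exact mem_biUnion ht ⟨hzt, hzy⟩
  rw [hT.closure_biUnion] at hyU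
  obtain ⟨t, ht, hyt⟩ := mem_iUnion₂.1 hyU
  obtain ⟨b, hb⟩ := closure_nonempty_iff.1 ⟨_, hyt⟩
  exact ⟨_, ⟨t, ht, closure_mono inter_subset_left hyt, b, hb⟩, s, hs, hys, a, ha, hya⟩

end Covers

section Contacts

open Filter Topology

variable {n : ℕ} {θ : Fin n → ℝ} {w σ : Perm (Fin n)} {T : Set (Tile n)} {s t : Tile n}
  {l m : Fin n} {y : ℝ}

/-- The depths in `(a, b)` at which the side labeled `l` of the path `σ` meets the left side of the
tile `t`. -/
def contact (θ : Fin n → ℝ) (σ : Perm (Fin n)) (t : Tile n) (l : Fin n) (a b : ℝ) : Set ℝ :=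
  Ioo a b ∩ Ioo (depth θ σ (σ.symm l).val) (depth θ σ ((σ.symm l).val + 1)) ∩
    {y | abscissa θ σ y = t.left θ y}

theorem closure_contact_subset (θ : Fin n → ℝ) (σ : Perm (Fin n)) (t : Tile n) (l : Fin n)
    (a b : ℝ) : closure (contact θ σ t l a b) ⊆
      Icc a b ∩ Icc (depth θ σ (σ.symm l).val) (depth θ σ ((σ.symm l).val + 1)) ∩
        {y | abscissa θ σ y = t.left θ y} :=
  closure_minimal (inter_subset_inter_left _
      (inter_subset_inter Ioo_subset_Icc_self Ioo_subset_Icc_self))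
    ((isClosed_Icc.inter isClosed_Icc).inter (isClosed_eq (by fun_prop) (by fun_prop)))

theorem hasDerivAt_affine (c d r y : ℝ) : HasDerivAt (fun z => c + r * (z - d)) r y := by
  simpa using (((hasDerivAt_id y).sub_const d).const_mul r).const_add c

theorem hasDerivAt_abscissa (hθ : Admissible θ)
    (hy : y ∈ Ioo (depth θ σ m.val) (depth θ σ (m.val + 1))) :
    HasDerivAt (abscissa θ σ) (slope θ (σ m)) y := by
  refine (hasDerivAt_affine (pathVertex θ σ m.val).re (depth θ σ m.val) _ y)
    |>.congr_of_eventuallyEq ?_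
  filter_upwards [Ioo_mem_nhds hy.1 hy.2] with z hz
  exact abscissa_of_mem_Icc hθ (Ioo_subset_Icc_self hz)

theorem Tile.hasDerivAt_left_of_lt_mid (hθ : Admissible θ) (hy : y < t.mid θ) :
    HasDerivAt (t.left θ) (slope θ t.i) y := by
  refine (hasDerivAt_affine t.top.re t.start _ y).congr_of_eventuallyEq ?_
  filter_upwards [Iio_mem_nhds hy] with z hz
  exact Tile.left_of_le_mid hθ (le_of_lt hz)

theorem Tile.hasDerivAt_left_of_mid_lt (hθ : Admissible θ) (hy : t.mid θ < y) :
    HasDerivAt (t.left θ) (slope θ t.j) y := by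
  refine (hasDerivAt_affine (t.top.re + slope θ t.i * height θ t.i) (t.mid θ) _ y)
    |>.congr_of_eventuallyEq ?_
  filter_upwards [Ioi_mem_nhds hy] with z hz
  rw [Tile.left_of_mid_le hθ (le_of_lt hz), add_assoc]

theorem exists_cornerTile_eq (hθ : Admissible θ)
    (hi : t.mid θ ∈ Ioc (depth θ σ (σ.symm t.i).val) (depth θ σ ((σ.symm t.i).val + 1)))
    (hj : t.mid θ ∈ Ico (depth θ σ (σ.symm t.j).val) (depth θ σ ((σ.symm t.j).val + 1)))
    (heq : abscissa θ σ (t.mid θ) = t.left θ (t.mid θ)) :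
    ∃ (m m' : Fin n) (_ : m'.val = m.val + 1) (hlt : σ m < σ m'), cornerTile θ σ m m' hlt = t := by
  have hmid : t.mid θ = t.start + height θ t.i := rfl
  obtain ⟨m, hm⟩ := σ.surjective t.i
  obtain ⟨m', hm'⟩ := σ.surjective t.j
  have hlt : σ m < σ m' := by rw [hm, hm']; exact t.lt
  rw [← hm, symm_apply_apply] at hi
  rw [← hm', symm_apply_apply] at hj
  have hmm' : m < m' := by
    refine lt_of_le_of_ne ?_ fun h => hlt.ne (congrArg σ h)
    exact Nat.lt_succ_iff.1 ((depth_mono hθ σ).reflect_lt (hi.1.trans hj.2))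
  have hdepth : depth θ σ m'.val ≤ depth θ σ (m.val + 1) := hj.1.trans hi.2
  have hsucc : m'.val = m.val + 1 := by
    refine le_antisymm ?_ hmm'
    by_contra! hgt
    have hstep := depth_lt_depth_succ hθ σ ⟨m.val + 1, hgt.trans m'.isLt⟩
    exact (hstep.trans_le (depth_mono hθ σ hgt)).not_ge hdepth
  have hstart : t.start = depth θ σ m.val := by
    have hbot : t.mid θ = depth θ σ (m.val + 1) := le_antisymm hi.2 (hsucc ▸ hj.1)
    rw [depth_succ, hm, hmid] at hbot
    exact add_right_cancel hbot
  have htop : pathVertex θ σ m.val = t.top := by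
    rw [abscissa_of_mem_Icc hθ (Ioc_subset_Icc_self hi), Tile.left_of_le_mid hθ le_rfl, hm,
      hstart] at heq
    exact Complex.ext (add_right_cancel heq) (neg_injective hstart.symm)
  refine ⟨m, m', hsucc, hlt, ?_⟩
  cases t
  simp only [cornerTile, Tile.mk.injEq]
  exact ⟨htop, hm, hm'⟩

namespace IsPartialTiling

theorem abscissa_le_left (hθ : Admissible θ) (h : IsPartialTiling θ w σ T) (ht : t ∈ T)
    (hy : y ∈ Icc t.start (t.finish θ)) : abscissa θ σ y ≤ t.left θ y := by
  have hp : (⟨t.left θ y, -y⟩ : ℂ) ∈ t.carrier θ := by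
    rw [t.carrier_eq_between hθ, mem_between, neg_neg]
    exact ⟨le_rfl, Tile.left_le_right hθ hy⟩
  simpa using (h.subset t ht hp).2.1

theorem right_le_abscissa (hθ : Admissible θ) (h : IsPartialTiling θ w σ T) (ht : t ∈ T)
    (hy : y ∈ Icc t.start (t.finish θ)) : t.right θ y ≤ abscissa θ w y := by
  have hp : (⟨t.right θ y, -y⟩ : ℂ) ∈ t.carrier θ := by
    rw [t.carrier_eq_between hθ, mem_between, neg_neg]
    exact ⟨Tile.left_le_right hθ hy, le_rfl⟩
  simpa using (h.subset t ht hp).2.2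

theorem abscissa_lt (hθ : Admissible θ) (h : IsPartialTiling θ w σ T) (ht : t ∈ T)
    (hy : y ∈ Ioo t.start (t.finish θ)) : abscissa θ σ y < abscissa θ w y :=
  have hy' := Ioo_subset_Icc_self hy
  (h.abscissa_le_left hθ ht hy').trans_lt
    ((Tile.left_lt_right hθ hy).trans_le (h.right_le_abscissa hθ ht hy'))

theorem exists_mem_carrier (hθ : Admissible θ) (h : IsPartialTiling θ w σ T)
    (hy : abscissa θ σ y < abscissa θ w y) : ∃ t ∈ T, (⟨abscissa θ σ y, -y⟩ : ℂ) ∈ t.carrier θ := by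
  have hclosed : IsClosed (⋃ t ∈ T, t.carrier θ) :=
    h.finite.isClosed_biUnion fun t _ => t.isClosed_carrier hθ
  have hcont : Continuous fun x : ℝ => (⟨x, -y⟩ : ℂ) :=
    Complex.equivRealProdCLM.symm.continuous.comp (by fun_prop : Continuous fun x : ℝ => (x, -y))
  have hsub : Ioo (abscissa θ σ y) (abscissa θ w y) ⊆
      (fun x : ℝ => (⟨x, -y⟩ : ℂ)) ⁻¹' ⋃ t ∈ T, t.carrier θ := fun x hx => by
    obtain ⟨t, ht, htx⟩ := h.cover ⟨x, -y⟩ (by simpa using hx.1) (by simpa using hx.2.le)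
    exact mem_biUnion ht htx
  have hmem := closure_minimal hsub (hclosed.preimage hcont)
    ((closure_Ioo hy.ne).ge (left_mem_Icc.2 hy.le))
  obtain ⟨t, ht, htp⟩ := mem_iUnion₂.1 hmem
  exact ⟨t, ht, htp⟩

theorem eq_of_left_eq (hθ : Admissible θ) (h : IsPartialTiling θ w σ T) (hs : s ∈ T) (ht : t ∈ T)
    (hys : y ∈ Ioo s.start (s.finish θ)) (hyt : y ∈ Ioo t.start (t.finish θ))
    (heq : s.left θ y = t.left θ y) : s = t := by
  by_contra hst
  obtain ⟨x, hx, hx'⟩ := exists_between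
    (lt_min (Tile.left_lt_right hθ hys) (heq.trans_lt (Tile.left_lt_right hθ hyt)))
  rw [lt_min_iff] at hx'
  have hp : (⟨x, -y⟩ : ℂ) ∈ interior (s.carrier θ) :=
    Tile.mem_interior_carrier hθ (by simpa using hx) (by simpa using hx'.1)
  have hp' : (⟨x, -y⟩ : ℂ) ∈ interior (t.carrier θ) :=
    Tile.mem_interior_carrier hθ (by simpa using heq ▸ hx) (by simpa using hx'.2)
  exact disjoint_left.1 (h.disjoint s hs t ht hst) hp hp'

/-- Where a tile touches the path `σ` from the right, the two are tangent. -/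
theorem apply_eq_of_hasDerivAt_left (hθ : Admissible θ) (h : IsPartialTiling θ w σ T) (ht : t ∈ T)
    (hy : y ∈ Ioo t.start (t.finish θ)) (heq : abscissa θ σ y = t.left θ y)
    (hm : y ∈ Ioo (depth θ σ m.val) (depth θ σ (m.val + 1)))
    (hl : HasDerivAt (t.left θ) (slope θ l) y) : σ m = l := by
  have hmax : IsLocalMax (fun z => abscissa θ σ z - t.left θ z) y := by
    filter_upwards [Ioo_mem_nhds hy.1 hy.2] with z hz
    rw [heq, sub_self, sub_nonpos]
    exact h.abscissa_le_left hθ ht (Ioo_subset_Icc_self hz)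
  have hzero := hmax.hasDerivAt_eq_zero ((hasDerivAt_abscissa hθ hm).sub hl)
  exact hθ.slope_strictMono.injective (sub_eq_zero.1 hzero)

end IsPartialTiling

/-- The depths of the vertices of the path `σ` and of the tiles. -/
def breakpoints (θ : Fin n → ℝ) (σ : Perm (Fin n)) (T : Set (Tile n)) : Set ℝ :=
  (⋃ t ∈ T, {t.start, t.mid θ, t.finish θ}) ∪ depth θ σ '' Iic n

namespace IsPartialTiling

theorem finite_breakpoints (h : IsPartialTiling θ w σ T) : (breakpoints θ σ T).Finite :=
  (h.finite.biUnion fun _ _ => toFinite _).union ((finite_Iic n).image _)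

theorem exists_mem_contact (hθ : Admissible θ) (hn : 0 < n) (h : IsPartialTiling θ w σ T)
    (hy : abscissa θ σ y < abscissa θ w y) (hbreak : y ∉ breakpoints θ σ T) :
    ∃ t ∈ T, y ∈ contact θ σ t t.i t.start (t.mid θ) ∪
      contact θ σ t t.j (t.mid θ) (t.finish θ) := by
  simp only [breakpoints, mem_union, mem_iUnion, mem_insert_iff, mem_singleton_iff, mem_image,
    mem_Iic, not_or, not_exists, not_and] at hbreak
  obtain ⟨hbreakT, hbreakσ⟩ := hbreak
  obtain ⟨t, ht, htp⟩ := h.exists_mem_carrier hθ hy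
  obtain ⟨hstart, hmid, hfinish⟩ := hbreakT t ht
  have hIcc := Tile.depth_mem_Icc hθ htp
  rw [neg_neg] at hIcc
  have hIoo : y ∈ Ioo t.start (t.finish θ) :=
    ⟨hIcc.1.lt_of_ne' hstart, hIcc.2.lt_of_ne hfinish⟩
  have heq : abscissa θ σ y = t.left θ y := by
    rw [t.carrier_eq_between hθ, mem_between, neg_neg] at htp
    exact (h.abscissa_le_left hθ ht hIcc).antisymm htp.1
  obtain ⟨m, hm⟩ := exists_mem_Icc_depth hθ hn σ (mem_Icc_of_abscissa_ne hθ hy.ne)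
  have hm : y ∈ Ioo (depth θ σ m.val) (depth θ σ (m.val + 1)) :=
    ⟨hm.1.lt_of_ne (hbreakσ _ m.isLt.le), hm.2.lt_of_ne' (hbreakσ _ m.isLt)⟩
  refine ⟨t, ht, (lt_or_gt_of_ne hmid).imp (fun hlt => ?_) fun hgt => ?_⟩
  · have hlabel := h.apply_eq_of_hasDerivAt_left hθ ht hIoo heq hm
      (Tile.hasDerivAt_left_of_lt_mid hθ hlt)
    refine ⟨⟨⟨hIoo.1, hlt⟩, ?_⟩, heq⟩
    rwa [← hlabel, symm_apply_apply]
  · have hlabel := h.apply_eq_of_hasDerivAt_left hθ ht hIoo heq hm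
      (Tile.hasDerivAt_left_of_mid_lt hθ hgt)
    refine ⟨⟨⟨hgt, hIoo.2⟩, ?_⟩, heq⟩
    rwa [← hlabel, symm_apply_apply]

theorem exists_mem_closure_contact (hθ : Admissible θ) (hn : 0 < n)
    (h : IsPartialTiling θ w σ T) (hT : T.Nonempty) :
    ∃ y, (∃ t ∈ T, y ∈ closure (contact θ σ t t.i t.start (t.mid θ)) ∧
        ∃ a ∈ contact θ σ t t.i t.start (t.mid θ), a < y) ∧
      ∃ s ∈ T, y ∈ closure (contact θ σ s s.j (s.mid θ) (s.finish θ)) ∧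
        ∃ a ∈ contact θ σ s s.j (s.mid θ) (s.finish θ), y ≤ a := by
  refine exists_mem_closure_of_isOpen (V := {y | abscissa θ σ y < abscissa θ w y})
    h.finite (isOpen_lt (by fun_prop) (by fun_prop)) ?_ ?_ h.finite_breakpoints ?_ ?_ ?_
  · obtain ⟨t, ht⟩ := hT
    exact ⟨_, h.abscissa_lt hθ ht ⟨t.start_lt_mid hθ, t.mid_lt_finish hθ⟩⟩
  · exact (Metric.isBounded_Icc _ _).subset fun y hy => mem_Icc_of_abscissa_ne hθ (ne_of_lt hy)
  · rintro y ⟨hy, hbreak⟩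
    obtain ⟨t, ht, hyt⟩ := h.exists_mem_contact hθ hn hy hbreak
    exact mem_biUnion ht hyt
  · intro t ht a ha z hz haz
    have hz' := (closure_contact_subset _ _ _ _ _ _ hz).1.1
    exact h.abscissa_lt hθ ht ⟨ha.1.1.1.trans_le haz, hz'.2.trans_lt (t.mid_lt_finish hθ)⟩
  · intro t ht a ha z hz hza
    have hz' := (closure_contact_subset _ _ _ _ _ _ hz).1.1
    exact h.abscissa_lt hθ ht ⟨(t.start_lt_mid hθ).trans_le hz'.1, hza.trans_lt ha.1.1.2⟩

theorem exists_cornerTile_mem (hθ : Admissible θ) (hn : 0 < n) (h : IsPartialTiling θ w σ T)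
    (hT : T.Nonempty) :
    ∃ (m m' : Fin n) (_ : m'.val = m.val + 1) (hlt : σ m < σ m'), cornerTile θ σ m m' hlt ∈ T := by
  obtain ⟨y, ⟨t, ht, hyt, b, hb, hby⟩, s, hs, hys, a, ha, hya⟩ :=
    h.exists_mem_closure_contact hθ hn hT
  obtain ⟨⟨hyt, hyi⟩, hyt_eq⟩ := closure_contact_subset _ _ _ _ _ _ hyt
  obtain ⟨⟨hys, hyj⟩, hys_eq⟩ := closure_contact_subset _ _ _ _ _ _ hys
  obtain rfl : s = t := h.eq_of_left_eq hθ hs ht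
    ⟨(s.start_lt_mid hθ).trans_le hys.1, hya.trans_lt ha.1.1.2⟩
    ⟨hb.1.1.1.trans hby, hyt.2.trans_lt (t.mid_lt_finish hθ)⟩ (hys_eq.symm.trans hyt_eq)
  obtain rfl : y = s.mid θ := hyt.2.antisymm hys.1
  obtain ⟨m, m', hm, hlt, rfl⟩ := exists_cornerTile_eq hθ ⟨hb.1.2.1.trans hby, hyi.2⟩
    ⟨hyj.1, hya.trans_lt ha.1.2.2⟩ hys_eq
  exact ⟨m, m', hm, hlt, hs⟩

theorem eq_of_empty (hθ : Admissible θ) (h : IsPartialTiling θ w σ ∅) : σ = w := by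
  refine abscissa_injective hθ (h.le.antisymm fun y => not_lt.1 fun hy => ?_)
  obtain ⟨t, ht, -⟩ := h.exists_mem_carrier hθ hy
  exact ht

theorem peels (hθ : Admissible θ) (hn : 0 < n) (h : IsPartialTiling θ w σ T) :
    Peels θ w σ T := by
  induction hcard : T.ncard generalizing σ T with
  | zero =>
    obtain rfl := (ncard_eq_zero h.finite).1 hcard
    obtain rfl := h.eq_of_empty hθ
    exact .refl
  | succ k ih =>
    have hT : T.Nonempty := (ncard_pos h.finite).1 (by omega)
    obtain ⟨m, m', hm, hlt, hc⟩ := h.exists_cornerTile_mem hθ hn hT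
    have hrest := ih (h.sdiff_cornerTile hθ hm hlt hc)
      (by rw [ncard_sdiff_singleton_of_mem hc, hcard, Nat.add_sub_cancel])
    have hstep := Peels.step σ m m' hm hlt _ hrest
    rwa [insert_sdiff_singleton, insert_eq_of_mem hc] at hstep

end IsPartialTiling

theorem IsRhombicTiling.peels (hθ : Admissible θ) (hn : 0 < n) {T : Finset (Tile n)}
    (h : IsRhombicTiling θ w T) : Peels θ w 1 (T : Set (Tile n)) :=
  (h.isPartialTiling hθ hn).peels hθ hn

end Contacts

section Segments

variable {a b c d x : ℂ}

theorem im_mem_Ioo_of_mem_openSegment (hab : b.im < a.im) (hx : x ∈ openSegment ℝ a b) :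
    x.im ∈ Ioo b.im a.im := by
  obtain ⟨r, s, hr, hs, hrs, rfl⟩ := hx
  simp only [Complex.add_im, Complex.smul_im, smul_eq_mul]
  obtain rfl : s = 1 - r := by linarith
  constructor <;> nlinarith

theorem eq_of_segment_eq (hab : b.im < a.im) (hcd : d.im < c.im)
    (h : segment ℝ a b = segment ℝ c d) : a = c ∧ b = d := by
  have key : ∀ {a b x : ℂ}, b.im < a.im → x ∈ segment ℝ a b →
      (x = a ∨ x.im < a.im) ∧ (x = b ∨ b.im < x.im) := by
    intro a b x hab hx
    rw [← insert_endpoints_openSegment] at hx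
    rcases hx with rfl | rfl | hx
    · exact ⟨.inl rfl, .inr hab⟩
    · exact ⟨.inr hab, .inl rfl⟩
    · have him := im_mem_Ioo_of_mem_openSegment hab hx
      exact ⟨.inr him.2, .inr him.1⟩
  have ha := (key hcd (h ▸ left_mem_segment ℝ a b)).1
  have hb := (key hcd (h ▸ right_mem_segment ℝ a b)).2
  have hc := (key hab (h ▸ left_mem_segment ℝ c d)).1
  have hd := (key hab (h ▸ right_mem_segment ℝ c d)).2
  exact ⟨ha.resolve_right fun hlt => hc.elim (fun e => (e ▸ hlt).false) hlt.not_gt,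
    hb.resolve_right fun hlt => hd.elim (fun e => (e ▸ hlt).false) hlt.not_gt⟩

end Segments

theorem mem_iff_mem_of_sum_eq {ι : Type*} {A B : Finset ι} {g : ι → ℝ}
    (hB : ∀ v ∈ B, g v ≤ 0) (hB' : ∀ v ∉ B, 0 ≤ g v) (h : ∑ v ∈ A, g v = ∑ v ∈ B, g v) {v : ι}
    (hv : g v ≠ 0) : v ∈ A ↔ v ∈ B := by
  classical
  have hA : ∀ u ∈ A \ B, 0 ≤ g u := fun u hu => hB' u (Finset.mem_sdiff.1 hu).2
  have hBA : ∀ u ∈ B \ A, g u ≤ 0 := fun u hu => hB u (Finset.mem_sdiff.1 hu).1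
  have heq : ∑ u ∈ A \ B, g u = ∑ u ∈ B \ A, g u := Finset.sum_sdiff_eq_sum_sdiff_iff.2 h
  have hzero : ∑ u ∈ A \ B, g u = 0 :=
    le_antisymm (heq.trans_le (Finset.sum_nonpos hBA)) (Finset.sum_nonneg hA)
  constructor <;> intro hmem <;> by_contra hnot
  · exact hv ((Finset.sum_eq_zero_iff_of_nonneg hA).1 hzero v (Finset.mem_sdiff.2 ⟨hmem, hnot⟩))
  · exact hv ((Finset.sum_eq_zero_iff_of_nonpos hBA).1 (heq.symm.trans hzero) v
      (Finset.mem_sdiff.2 ⟨hmem, hnot⟩))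

section LeftBoundary

variable {n : ℕ} {θ : Fin n → ℝ} {w σ : Perm (Fin n)} {T : Set (Tile n)} {t : Tile n}
  {k k' m v : Fin n} {p q : ℂ} {i j : Fin n}

theorem dir_injective (hθ : Admissible θ) : Function.Injective (dir θ) := by
  intro i j h
  have hre := congrArg Complex.re h
  have him := congrArg Complex.im h
  rw [dir_im, dir_im, neg_inj] at him
  rw [hθ.dir_re, hθ.dir_re, him] at hre
  exact hθ.slope_strictMono.injective (mul_right_cancel₀ (hθ.height_pos j).ne' hre)

theorem eq_of_segment_add_dir_eq (hθ : Admissible θ)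
    (h : segment ℝ p (p + dir θ i) = segment ℝ q (q + dir θ j)) : p = q ∧ i = j := by
  have hlt : ∀ (p : ℂ) (i : Fin n), (p + dir θ i).im < p.im := fun p i => by
    rw [Complex.add_im, dir_im]
    linarith [hθ.height_pos i]
  obtain ⟨rfl, hdir⟩ := eq_of_segment_eq (hlt p i) (hlt q j) h
  exact ⟨rfl, dir_injective hθ (add_left_cancel hdir)⟩

theorem eq_of_segment_mem_edges (hθ : Admissible θ) (h : segment ℝ p (p + dir θ m) ∈ t.edges θ) :
    (m = t.i ∧ (p = t.top ∨ p = t.top + dir θ t.j)) ∨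
      (m = t.j ∧ (p = t.top ∨ p = t.top + dir θ t.i)) := by
  rcases h with h | h | h | h
  · obtain ⟨hp, hm⟩ := eq_of_segment_add_dir_eq hθ h
    exact .inl ⟨hm, .inl hp⟩
  · obtain ⟨hp, hm⟩ := eq_of_segment_add_dir_eq hθ h
    exact .inr ⟨hm, .inl hp⟩
  · rw [add_right_comm] at h
    obtain ⟨hp, hm⟩ := eq_of_segment_add_dir_eq hθ h
    exact .inl ⟨hm, .inr hp⟩
  · obtain ⟨hp, hm⟩ := eq_of_segment_add_dir_eq hθ h
    exact .inr ⟨hm, .inr hp⟩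

theorem leftEdge_eq_segment (θ : Fin n → ℝ) (m : Fin n) :
    leftEdge θ m = segment ℝ (pathVertex θ 1 m.val) (pathVertex θ 1 m.val + dir θ m) := by
  rw [leftEdge, pathEdge, pathVertex_succ, Perm.one_apply]

theorem sharesLeft_cornerTile_one (θ : Fin n → ℝ) (hk : k'.val = k.val + 1) (h : k < k') :
    SharesLeft θ (cornerTile θ 1 k k' h) := by
  refine ⟨k, k', hk, ?_, ?_⟩
  · rw [leftEdge_eq_segment]
    exact .inl rfl
  · rw [leftEdge_eq_segment, hk, pathVertex_succ]
    exact .inr (.inr (.inr rfl))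

theorem SharesLeft.top_eq (hθ : Admissible θ) (h : SharesLeft θ t) :
    t.top = pathVertex θ 1 t.i.val := by
  obtain ⟨m, m', hm, hedge, hedge'⟩ := h
  rw [leftEdge_eq_segment] at hedge hedge'
  have hlt : t.i.val < t.j.val := t.lt
  have hi := hθ.height_pos t.i
  have hj := hθ.height_pos t.j
  rcases eq_of_segment_mem_edges hθ hedge with ⟨rfl, htop⟩ | ⟨rfl, -⟩ <;>
    rcases eq_of_segment_mem_edges hθ hedge' with ⟨rfl, -⟩ | ⟨rfl, htop'⟩
  · omega
  · rcases htop with htop | htop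
    · exact htop.symm
    · -- The second edge would start too deep for a side of `t`.
      rw [hm, pathVertex_succ, htop, Perm.one_apply] at htop'
      rcases htop' with htop' | htop' <;> have him := congrArg Complex.im htop' <;>
        simp only [Complex.add_im, dir_im] at him <;> linarith
  · omega
  · omega

theorem symm_lt_iff_of_pathVertex_eq (hθ : Admissible θ) {l : ℕ}
    (h : pathVertex θ σ l = pathVertex θ 1 k.val) (hv : v ≠ k) : (σ.symm v).val < l ↔ v < k := by
  -- `f` vanishes on the direction `k`, so among all sums of distinct directions it is minimal at
  -- the left vertex number `k`.
  let f : ℂ →ₗ[ℝ] ℝ := Complex.reLm + slope θ k • Complex.imLm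
  have hf : ∀ u, f (dir θ u) = (slope θ u - slope θ k) * height θ u := fun u => by
    simp only [f, LinearMap.add_apply, LinearMap.smul_apply, Complex.reLm_coe, Complex.imLm_coe,
      hθ.dir_re, dir_im, smul_eq_mul]
    ring
  rw [pathVertex_eq_sum_labels, pathVertex_eq_sum_labels, Perm.one_def, refl_symm] at h
  have hsum := congrArg f h
  rw [map_sum, map_sum] at hsum
  have hiff := mem_iff_mem_of_sum_eq (v := v) (fun u hu => ?_) (fun u hu => ?_) hsum ?_
  · simpa using hiff
  · have hu : u < k := by simpa using hu
    rw [hf]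
    exact mul_nonpos_of_nonpos_of_nonneg (sub_nonpos.2 (hθ.slope_strictMono hu).le)
      (hθ.height_pos u).le
  · have hu : k ≤ u := by simpa using hu
    rw [hf]
    exact mul_nonneg (sub_nonneg.2 (hθ.slope_strictMono.monotone hu)) (hθ.height_pos u).le
  · rw [hf]
    exact mul_ne_zero (sub_ne_zero.2 (hθ.slope_strictMono.injective.ne hv)) (hθ.height_pos v).ne'

theorem Tile.eq_of_labels_eq_pair (hk : k < k') (h : t.labels = {k, k'}) : t.i = k ∧ t.j = k' := by
  refine (pair_eq_pair_iff.1 h).resolve_right ?_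
  rintro ⟨rfl, rfl⟩
  exact hk.not_gt t.lt

/-- Undoing the descent of `σ` that consists of the labels of `t` gives a tiling whose tile with
these labels has its top vertex away from the leftside boundary. -/
theorem not_isForcedLeftTile_of_descent (hθ : Admissible θ) (hn : 2 ≤ n) (hw : FullySupported w)
    (h : Peels θ w σ T) (hadj : (σ.symm t.i).val = (σ.symm t.j).val + 1) (hvi : v ≠ t.i)
    (hvj : v ≠ t.j) (hv : ¬ (σ.symm v < σ.symm t.j ↔ v < t.i)) : ¬ IsForcedLeftTile θ w t := by
  intro hforced
  have hstep := h.undo hadj (by simpa using t.lt)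
  obtain ⟨T', hT', hp⟩ := hstep.exists_one
  obtain ⟨ht, hleft⟩ := hforced _ (hp.isRhombicTiling hθ hn hw)
  have heq := hp.eq_of_labels (hp.finite.mem_toFinset.1 ht) (hT' (mem_insert _ _))
    (by simp [cornerTile]) (by simp [cornerTile])
  have htop : pathVertex θ (σ * swap (σ.symm t.j) (σ.symm t.i)) (σ.symm t.j).val
      = pathVertex θ 1 t.i.val := (congrArg Tile.top heq).symm.trans (hleft.top_eq hθ)
  have hiff := symm_lt_iff_of_pathVertex_eq hθ htop hvi
  rw [symm_mul_swap_apply,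
    swap_apply_of_ne_of_ne (σ.symm.injective.ne hvj) (σ.symm.injective.ne hvi)] at hiff
  exact hv hiff

theorem IsForcedLeftTile.symm_lt_symm (hθ : Admissible θ) (hn : 2 ≤ n) (hw : FullySupported w)
    (h : IsForcedLeftTile θ w t) : w.symm t.j < w.symm t.i := by
  obtain ⟨T, -, hT⟩ := (Peels.refl (θ := θ) (w := w)).exists_one
  exact hT.inv_of_mem (hT.finite.mem_toFinset.1 (h _ (hT.isRhombicTiling hθ hn hw)).1)

theorem IsForcedLeftTile.not_togetherIn321 (hθ : Admissible θ) (hn : 2 ≤ n)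
    (hw : FullySupported w) (hk : t.j.val = t.i.val + 1) (h : IsForcedLeftTile θ w t) :
    ¬ TogetherIn321 w t.i t.j := by
  rintro ⟨a, b, c, hab, hbc, hba, hcb, hi, hj⟩
  obtain ⟨σ, T, hT, hσab, hσbc⟩ := (Peels.refl (θ := θ) (w := w)).exists_consecutive hba hcb
    (by simpa using hab) (by simpa using hbc)
  have hcases : (t.j = w a ∧ t.i = w b) ∨ (t.j = w b ∧ t.i = w c) := by
    simp only [mem_insert_iff, mem_singleton_iff, Fin.ext_iff, Fin.lt_def]
      at hi hj hba hcb ⊢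
    omega
  rcases hcases with ⟨hja, hib⟩ | ⟨hjb, hic⟩
  · rw [← hja, ← hib] at hσab
    rw [← hja] at hba
    rw [← hib] at hba hcb hσbc
    refine not_isForcedLeftTile_of_descent hθ hn hw hT hσab hcb.ne (hcb.trans hba).ne ?_ h
    intro hiff
    have hlt : (σ.symm (w c)).val < (σ.symm t.j).val := hiff.2 hcb
    omega
  · rw [← hjb, ← hic] at hσbc
    rw [← hjb] at hba hcb hσab
    rw [← hic] at hcb
    refine not_isForcedLeftTile_of_descent hθ hn hw hT hσbc (hcb.trans hba).ne' hba.ne' ?_ h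
    intro hiff
    exact (hiff.1 (Fin.lt_def.2 (by omega))).not_gt (hcb.trans hba)

theorem isForcedLeftTile_cornerTile_one (hθ : Admissible θ) (hn : 0 < n)
    (hk : k'.val = k.val + 1) (hkk' : k < k') (hmax : IsLRMax w k') (hmin : IsRLMin w k)
    (hinv : w.symm k' < w.symm k) : IsForcedLeftTile θ w (cornerTile θ 1 k k' hkk') := by
  refine fun T hT => ⟨?_, sharesLeft_cornerTile_one θ hk hkk'⟩
  obtain ⟨σ, T', m, m', hlt, hp, hmm', rfl, rfl, hmem⟩ := (hT.peels hθ hn).exists_crossing hkk' hinv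
  have hprefix := hp.symm_lt_symm_iff_of_isLRMax hk hmax hmin (by simpa using hmm')
  have htop : pathVertex θ σ m.val = pathVertex θ 1 (σ m).val :=
    pathVertex_congr θ fun v => by simpa [Perm.one_def] using hprefix v
  have heq : cornerTile θ σ m m' hlt = cornerTile θ 1 (σ m) (σ m') hkk' := by
    simp only [cornerTile, htop, Perm.one_apply]
  exact heq ▸ hmem

end LeftBoundary

end Elnitsky

end

theorem corollary4 {n : ℕ} (θ : Fin n → ℝ) (hθ : Elnitsky.Admissible θ)
    (w : Equiv.Perm (Fin n)) (hw : Elnitsky.FullySupported w)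
    (k k' : Fin n) (hk : k'.val = k.val + 1) :
    ((∃ t : Elnitsky.Tile n, t.labels = {k, k'} ∧ Elnitsky.IsForcedLeftTile θ w t) ↔
      (w.symm k' < w.symm k ∧ ¬ Elnitsky.TogetherIn321 w k k')) ∧
    ((w.symm k' < w.symm k ∧ ¬ Elnitsky.TogetherIn321 w k k') ↔
      (Elnitsky.IsLRMax w k' ∧ Elnitsky.IsRLMin w k)) := by
  have hn : 2 ≤ n := by omega
  have hkk' : k < k' := by rw [Fin.lt_def]; omega
  have hpattern := hw.not_togetherIn321_iff hk
  refine ⟨⟨?_, fun h => ?_⟩, hpattern⟩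
  · rintro ⟨t, hlabels, ht⟩
    obtain ⟨rfl, rfl⟩ := Elnitsky.Tile.eq_of_labels_eq_pair hkk' hlabels
    exact ⟨ht.symm_lt_symm hθ hn hw, ht.not_togetherIn321 hθ hn hw hk⟩
  · obtain ⟨hmax, hmin⟩ := hpattern.1 h
    exact ⟨_, rfl, Elnitsky.isForcedLeftTile_cornerTile_one hθ (by omega) hk hkk' hmax hmin h.1⟩
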